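/- Theorem 2.4. Let $n\ge 1$, let $\Omega\subset\mathbb{R}^n$ be a bounded convex domain, fix a point $P\in\partial\Omega$, and let $0<\alpha<1$. For $Q\in\Omega$ put $r=|Q-P|$, $\mathbf{e}=(Q-P)/r$, and let $d=d(\mathbf{e})$ be the length of the segment cut out of $\Omega$ by the ray from $P$ in the direction $\mathbf{e}$. For complex-valued $g\in L_2(\Omega)$ and almost every $Q\in\Omega$ define the left-side and right-side directional fractional integrals $$(\mathfrak{J}_{0+}^{\alpha}g)(Q)=\frac{1}{\Gamma(\alpha)}\int_0^r\frac{g(P+t\mathbf{e})}{(r-t)^{1-\alpha}}\left(\frac{t}{r}\right)^{n-1}dt,\qquad(\mathfrak{J}_{d-}^{\alpha}g)(Q)=\frac{1}{\Gamma(\alpha)}\int_r^{d}\frac{g(P+t\mathbf{e})}{(t-r)^{1-\alpha}}\,dt .$$ Let $\mathfrak{J}_{0+}^{\alpha}(L_2)$ and $\mathfrak{J}_{d-}^{\alpha}(L_2)$ be the classes of functions $u$ on $\Omega$ for which there is a $g\in L_2(\Omega)$ such that, for almost every $Q\in\Omega$, the integral defining $(\mathfrak{J}_{0+}^{\alpha}g)(Q)$,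 respectively $(\mathfrak{J}_{d-}^{\alpha}g)(Q)$, converges absolutely and equals $u(Q)$. Suppose that $\alpha<\lambda\le 1$, that $\rho\in\mathrm{Lip}\,\lambda$, that is, $\rho:\overline{\Omega}\to\mathbb{C}$ satisfies $|\rho(Q)-\rho(Q')|\le M|Q-Q'|^{\lambda}$ for some constant $M$ and all $Q,Q'\in\overline{\Omega}$, and that $f\in H_0^1(\Omega)$ (complex-valued), the closure of $C_0^\infty(\Omega)$ in $H^1(\Omega)$. Then $$\rho f\in\mathfrak{J}_{0+}^{\alpha}(L_2)\cap\mathfrak{J}_{d-}^{\alpha}(L_2).$$ -/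

import Mathlib

open MeasureTheory Filter Topology
open scoped ENNReal NNReal ContDiff

noncomputable section

namespace DirFrac

/-- The Euclidean space of dimension `n`. -/
abbrev E (n : ℕ) : Type := EuclideanSpace ℝ (Fin n)

variable {n : ℕ}

/-! ### The spaces `Lip` and `H₀¹` -/

/-- `ρ ∈ Lip lam` : there is a constant `M` with `|ρ(Q) - ρ(P)| ≤ M |Q - P| ^ lam` for all `P, Q` in
the closure of `Ω`. -/
def IsLip (lam : ℝ≥0) (Ω : Set (E n)) (ρ : E n → ℂ) : Prop :=
  ∃ M : ℝ≥0, HolderOnWith M lam ρ (closure Ω)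

/-- `φ ∈ C₀^∞(Ω)` : smooth, complex valued, with compact support contained in `Ω`. -/
structure IsTest (Ω : Set (E n)) (φ : E n → ℂ) : Prop where
  smooth : ContDiff ℝ ∞ φ
  compact_support : HasCompactSupport φ
  support_subset : tsupport φ ⊆ Ω

/-- The classical partial derivative in the `i`-th coordinate. -/
def partialDeriv (i : Fin n) (φ : E n → ℂ) (x : E n) : ℂ :=
  fderiv ℝ φ x (EuclideanSpace.single i 1)

/-- `g` is the weak derivative `D_i f` on `Ω`. It is only used for `f` and `g` in `L₂(Ω)`, so that
both integrals converge. -/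
def IsWeakDeriv (Ω : Set (E n)) (i : Fin n) (f g : E n → ℂ) : Prop :=
  ∀ φ : E n → ℂ, IsTest Ω φ →
    ∫ x in Ω, f x * partialDeriv i φ x = - ∫ x in Ω, g x * φ x

/-- `f ∈ H₀¹(Ω)` : `f` lies in `L₂(Ω)` together with its first weak derivatives, and it is the limit
in the norm of `H¹(Ω)` of a sequence in `C₀^∞(Ω)`. -/
def MemH01 (Ω : Set (E n)) (f : E n → ℂ) : Prop :=
  MemLp f 2 (volume.restrict Ω) ∧
  ∃ Df : Fin n → E n → ℂ,
    (∀ i, MemLp (Df i) 2 (volume.restrict Ω) ∧ IsWeakDeriv Ω i f (Df i)) ∧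
    ∃ φ : ℕ → E n → ℂ, (∀ k, IsTest Ω (φ k)) ∧
      Tendsto (fun k => eLpNorm (φ k - f) 2 (volume.restrict Ω)) atTop (𝓝 0) ∧
      ∀ i, Tendsto (fun k => eLpNorm (partialDeriv i (φ k) - Df i) 2 (volume.restrict Ω))
        atTop (𝓝 0)

/-! ### Directional fractional integrals -/

/-- The unit vector `𝐞` having the direction from `P` to `Q`. -/
def dir (P Q : E n) : E n := ‖Q - P‖⁻¹ • (Q - P)

/-- `d(𝐞)`, the length of the segment cut out of `Ω` by the ray going from `P` in the direction `e`.
If `Ω` is open, bounded and convex and `P` is one of its boundary points, then the set below is the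
interval `(0, d(𝐞))`, or it is empty. -/
def rayLength (Ω : Set (E n)) (P e : E n) : ℝ := sSup {t : ℝ | 0 < t ∧ P + t • e ∈ Ω}

/-- The integrand `g(T) (r - t)^{-(1 - α)} (t / r)^{n - 1}`, where `T = P + t 𝐞` and `r = |Q - P|`,
of the left-side integral. (For `n = 0` there are no boundary points `P`, so the subtraction in the
exponent is harmless.) -/
def leftIntegrand (α : ℝ) (P : E n) (g : E n → ℂ) (Q : E n) (t : ℝ) : ℂ :=
  g (P + t • dir P Q) / (((‖Q - P‖ - t) ^ (1 - α) : ℝ) : ℂ) * (((t / ‖Q - P‖) ^ (n - 1) : ℝ) : ℂ)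

/-- The integrand `g(T) (t - r)^{-(1 - α)}`, where `T = P + t 𝐞` and `r = |Q - P|`, of the
right-side integral. -/
def rightIntegrand (α : ℝ) (P : E n) (g : E n → ℂ) (Q : E n) (t : ℝ) : ℂ :=
  g (P + t • dir P Q) / (((t - ‖Q - P‖) ^ (1 - α) : ℝ) : ℂ)

/-- The left-side directional fractional integral `(𝔍_{0+}^α g)(Q)`, over `0 < t < r`. -/
def leftInt (α : ℝ) (P : E n) (g : E n → ℂ) (Q : E n) : ℂ :=
  1 / (Real.Gamma α : ℂ) * ∫ t in (0 : ℝ)..‖Q - P‖, leftIntegrand α P g Q t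

/-- The right-side directional fractional integral `(𝔍_{d-}^α g)(Q)`, over `r < t < d(𝐞)`. -/
def rightInt (α : ℝ) (Ω : Set (E n)) (P : E n) (g : E n → ℂ) (Q : E n) : ℂ :=
  1 / (Real.Gamma α : ℂ) *
    ∫ t in ‖Q - P‖..rayLength Ω P (dir P Q), rightIntegrand α P g Q t

/-- The class `𝔍_{0+}^α(L_p)` : the functions `u` on `Ω` with `u = 𝔍_{0+}^α g` almost everywhere, for
some `g ∈ L_p(Ω)`; the integral is required to converge absolutely at almost every point. -/
def LeftClass (α : ℝ) (p : ℝ≥0∞) (Ω : Set (E n)) (P : E n) : Set (E n → ℂ) :=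
  {u | ∃ g : E n → ℂ, MemLp g p (volume.restrict Ω) ∧
    ∀ᵐ Q ∂(volume.restrict Ω),
      IntervalIntegrable (leftIntegrand α P g Q) volume 0 ‖Q - P‖ ∧ u Q = leftInt α P g Q}

/-- The class `𝔍_{d-}^α(L_p)` : the functions `u` on `Ω` with `u = 𝔍_{d-}^α g` almost everywhere, for
some `g ∈ L_p(Ω)`; the integral is required to converge absolutely at almost every point. -/
def RightClass (α : ℝ) (p : ℝ≥0∞) (Ω : Set (E n)) (P : E n) : Set (E n → ℂ) :=
  {u | ∃ g : E n → ℂ, MemLp g p (volume.restrict Ω) ∧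
    ∀ᵐ Q ∂(volume.restrict Ω),
      IntervalIntegrable (rightIntegrand α P g Q) volume ‖Q - P‖ (rayLength Ω P (dir P Q)) ∧
        u Q = rightInt α Ω P g Q}

end DirFrac

end

namespace DirFrac
open Set

/-! ### Inversion of the Marchaud derivative on the line -/

section Line

/-! Let U be the extension of ρf by zero, recentred so that P is the origin. On a ray from P both
operators are one-dimensional fractional integrals of order α, and such an integral is inverted by
the Marchaud derivative ∫ s^(-1-α) (F(r) - F(r-s)) ds (`marchaud_inversion`). The preimage g is
therefore, up to a constant, the Marchaud derivative along rays: of t^(n-1) U for the left side and,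
after the reflection t ↦ -t, of U itself for the right side. It remains to see that g lies in L₂ and
that the inversion is legitimate on almost every ray.

The substitution s = |w|σ turns differences along a ray into differences between U and its dilates.
By Minkowski's inequality, g is in L₂ once two weighted bounds hold: ‖|w|^(-α) U‖ is finite, which
controls σ away from 0, and ‖|w|^(-α) (U - U(τ·))‖ ≤ K (τ-1)^λ for 1 ≤ τ ≤ 2, which controls small σ
because σ^(λ-1-α) is integrable at 0 when λ > α.

For test functions the first bound is Hardy's inequality (`exists_wn_le`) and the second, with
exponent 1, comes from integrating the gradient along dilations (`wn_sub_smul_le`). Fatou's lemma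
carries both to H₀¹ (`exists_zeroExtension`), and a product rule brings in ρ and the exponent λ
(`exists_zeroExtension_mul`), using that convexity makes Ω shrink into itself under dilations
towards P. The majorant `radMaj` that puts g in L₂ is also finite enough on almost every ray to
justify Fubini in the inversion. -/

theorem integral_kernel_swap {k : ℝ × ℝ → ℝ} (hk : Measurable k) (hk0 : ∀ p, 0 ≤ k p) {m : ℝ → ℝ}
    (hkm : ∀ w, 0 < w → IntegrableOn (fun s => k (s, w)) (Ioi 0) ∧ ∫ s in Ioi 0, k (s, w) = m w)
    {G : ℝ → ℂ} (hG : AEStronglyMeasurable G (volume.restrict (Ioi 0)))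
    (hm : IntegrableOn (fun w => m w • G w) (Ioi 0)) :
    ∫ s in Ioi 0, ∫ w in Ioi 0, k (s, w) • G w = ∫ w in Ioi 0, m w • G w := by
  have hmeas : AEStronglyMeasurable (fun p : ℝ × ℝ => k p • G p.2)
      ((volume.restrict (Ioi 0)).prod (volume.restrict (Ioi 0))) :=
    hk.aestronglyMeasurable.smul hG.comp_snd
  have hint : Integrable (fun p : ℝ × ℝ => k p • G p.2)
      ((volume.restrict (Ioi 0)).prod (volume.restrict (Ioi 0))) := by
    rw [integrable_prod_iff' hmeas]
    refine ⟨?_, ?_⟩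
    · filter_upwards [ae_restrict_mem measurableSet_Ioi] with w hw
      exact (hkm w hw).1.smul_const (G w)
    · refine (integrable_congr ?_).1 hm.norm
      filter_upwards [ae_restrict_mem measurableSet_Ioi] with w hw
      simp only [norm_smul, Real.norm_of_nonneg (hk0 _)]
      rw [integral_mul_const, (hkm w hw).2, Real.norm_of_nonneg]
      rw [← (hkm w hw).2]
      exact integral_nonneg fun s => hk0 _
  rw [integral_integral_swap hint]
  refine setIntegral_congr_fun measurableSet_Ioi fun w hw => ?_
  rw [integral_smul_const, (hkm w hw).2]

/-- The normalising constant `B(α, 1 - α)`. -/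
noncomputable def betaConst (α : ℝ) : ℝ := ∫ s in Ioo (0 : ℝ) 1, s ^ (α - 1) * (1 - s) ^ (-α)

theorem integrableOn_beta {α : ℝ} (h0 : 0 < α) (h1 : α < 1) :
    IntegrableOn (fun s : ℝ => s ^ (α - 1) * (1 - s) ^ (-α)) (Ioo 0 1) := by
  have h := Complex.betaIntegral_convergent (u := α) (v := (1 - α : ℝ)) (by simpa) (by simp; linarith)
  rw [intervalIntegrable_iff_integrableOn_Ioo_of_le zero_le_one] at h
  refine (integrableOn_congr_fun (fun s hs => ?_) measurableSet_Ioo).1 h.norm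
  have h1s : 0 < 1 - s := by linarith [hs.2]
  simp only [norm_mul]
  have e1 : ‖((s : ℂ) ^ ((α : ℂ) - 1))‖ = s ^ (α - 1) := by
    rw [Complex.norm_cpow_eq_rpow_re_of_pos hs.1]; simp
  have e2 : ‖((1 - s : ℂ) ^ (((1 - α : ℝ) : ℂ) - 1))‖ = (1 - s) ^ (-α) := by
    rw [show (1 - s : ℂ) = ((1 - s : ℝ) : ℂ) by push_cast; ring,
      Complex.norm_cpow_eq_rpow_re_of_pos h1s]; simp
  rw [e1, e2]

theorem betaConst_pos {α : ℝ} (h0 : 0 < α) (h1 : α < 1) : 0 < betaConst α := by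
  unfold betaConst
  rw [setIntegral_pos_iff_support_of_nonneg_ae]
  · have : Ioo (0 : ℝ) 1 ⊆ Function.support (fun s : ℝ => s ^ (α - 1) * (1 - s) ^ (-α)) := by
      intro s hs
      have : 0 < 1 - s := by linarith [hs.2]
      exact (mul_pos (Real.rpow_pos_of_pos hs.1 _) (Real.rpow_pos_of_pos this _)).ne'
    rw [inter_eq_right.2 this]; simp
  · filter_upwards [ae_restrict_mem measurableSet_Ioo] with s hs
    have : 0 < 1 - s := by linarith [hs.2]
    exact (mul_pos (Real.rpow_pos_of_pos hs.1 _) (Real.rpow_pos_of_pos this _)).le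
  · exact integrableOn_beta h0 h1

/-- The exponents add up to -1, so rescaling s = wσ leaves no power of w. -/
theorem beta_scaled {α : ℝ} (h0 : 0 < α) (h1 : α < 1) {w : ℝ} (hw : 0 < w) :
    IntegrableOn (fun s : ℝ => s ^ (α - 1) * (w - s) ^ (-α)) (Ioo 0 w) ∧
      ∫ s in Ioo 0 w, s ^ (α - 1) * (w - s) ^ (-α) = betaConst α := by
  set h : ℝ → ℝ := (Ioo (0 : ℝ) 1).indicator fun s => s ^ (α - 1) * (1 - s) ^ (-α) with hh
  have hi : Integrable h := (integrable_indicator_iff measurableSet_Ioo).2 (integrableOn_beta h0 h1)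
  have key : (Ioo (0 : ℝ) w).indicator (fun s => s ^ (α - 1) * (w - s) ^ (-α)) =
      fun s => w⁻¹ * h (w⁻¹ * s) := by
    funext s
    by_cases hs : s ∈ Ioo 0 w
    · have hs' : w⁻¹ * s ∈ Ioo (0 : ℝ) 1 := by
        refine ⟨mul_pos (inv_pos.2 hw) hs.1, ?_⟩
        rw [inv_mul_lt_iff₀ hw]; simpa using hs.2
      rw [indicator_of_mem hs, hh, indicator_of_mem hs']
      have e : 1 - w⁻¹ * s = w⁻¹ * (w - s) := by field_simp
      have hws : 0 ≤ w - s := by linarith [hs.2]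
      rw [e, Real.mul_rpow (inv_pos.2 hw).le hs.1.le, Real.mul_rpow (inv_pos.2 hw).le hws,
        Real.inv_rpow hw.le, Real.inv_rpow hw.le, Real.rpow_neg hw.le α, inv_inv,
        Real.rpow_sub_one hw.ne']
      have : w ^ α ≠ 0 := (Real.rpow_pos_of_pos hw _).ne'
      field_simp
    · have hs' : w⁻¹ * s ∉ Ioo (0 : ℝ) 1 := by
        rintro ⟨a, b⟩
        rw [inv_mul_lt_iff₀ hw] at b
        exact hs ⟨(pos_iff_pos_of_mul_pos a).1 (inv_pos.2 hw), by simpa using b⟩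
      rw [indicator_of_notMem hs, hh, indicator_of_notMem hs', mul_zero]
  constructor
  · rw [← integrable_indicator_iff measurableSet_Ioo, key]
    exact (hi.comp_mul_left' (inv_ne_zero hw.ne')).const_mul _
  · rw [← integral_indicator measurableSet_Ioo, key, integral_const_mul,
      Measure.integral_comp_mul_left, inv_inv, abs_of_pos hw, smul_eq_mul, hh,
      integral_indicator measurableSet_Ioo, betaConst]
    field_simp

/-- This is the semigroup law: fractional integration of order α after order 1-α is plain
integration. After Fubini the point w carries the mass of s^(α-1) (w-s)^(-α) on (0, w), which does
not depend on w. -/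
theorem integral_rpow_conv_shift {α : ℝ} (h0 : 0 < α) (h1 : α < 1) {G : ℝ → ℂ}
    (hG : IntegrableOn G (Ioi 0)) :
    ∫ s in Ioi (0 : ℝ), s ^ (α - 1) • ∫ v in Ioi (0 : ℝ), v ^ (-α) • G (s + v) =
      betaConst α • ∫ w in Ioi 0, G w := by
  set k : ℝ × ℝ → ℝ := {p | 0 < p.1 ∧ p.1 < p.2}.indicator
    (fun p => p.1 ^ (α - 1) * (p.2 - p.1) ^ (-α)) with hk
  have hset : MeasurableSet {p : ℝ × ℝ | 0 < p.1 ∧ p.1 < p.2} :=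
    (measurableSet_lt measurable_const measurable_fst).inter
      (measurableSet_lt measurable_fst measurable_snd)
  have hkm : Measurable k := by
    refine Measurable.indicator ?_ hset
    fun_prop
  have hk0 : ∀ p, 0 ≤ k p := by
    intro p
    refine indicator_nonneg (fun p hp => ?_) p
    exact mul_nonneg (Real.rpow_nonneg hp.1.le _) (Real.rpow_nonneg (by linarith [hp.2]) _)
  have hslice : ∀ w : ℝ, (fun s => k (s, w)) =
      (Ioo 0 w).indicator fun s => s ^ (α - 1) * (w - s) ^ (-α) := by
    intro w; funext s; simp only [hk, indicator, mem_Ioo, mem_ofPred_eq]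
  have := integral_kernel_swap hkm hk0 (m := fun _ => betaConst α) (G := G) ?_ hG.1
    (Integrable.smul (betaConst α) hG)
  · rw [integral_smul] at this
    rw [← this]
    refine setIntegral_congr_fun measurableSet_Ioi fun s hs => ?_
    rw [mem_Ioi] at hs
    have e1 : ∫ v in Ioi (0 : ℝ), v ^ (-α) • G (s + v) = ∫ w in Ioi s, (w - s) ^ (-α) • G w := by
      rw [← integral_indicator measurableSet_Ioi, ← integral_indicator measurableSet_Ioi,
        ← integral_sub_right_eq_self _ s]
      congr 1; funext w
      simp [indicator]
    have e2 : ∫ w in Ioi (0 : ℝ), k (s, w) • G w =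
        ∫ w in Ioi s, (s ^ (α - 1) * (w - s) ^ (-α)) • G w := by
      rw [← integral_indicator measurableSet_Ioi, ← integral_indicator measurableSet_Ioi]
      congr 1; funext w
      by_cases hw : s < w
      · simp [hk, indicator, hs, hw, hs.trans hw]
      · simp [hk, indicator, hw]
    rw [e1, e2, ← integral_smul]
    simp [mul_smul]
  · intro w hw
    rw [hslice, integral_indicator measurableSet_Ioo, IntegrableOn,
      integrable_indicator_iff measurableSet_Ioo, IntegrableOn, Measure.restrict_restrict measurableSet_Ioo, inter_eq_left.2 Ioo_subset_Ioi_self]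
    exact beta_scaled h0 h1 hw

/-- Fubini: a point v collects the integral of s^(-1-α) over s > v, which is v^(-α)/α. -/
theorem integral_rpow_primitive {α : ℝ} (h0 : 0 < α) {G : ℝ → ℂ}
    (hGm : AEStronglyMeasurable G (volume.restrict (Ioi 0)))
    (hG : IntegrableOn (fun v => v ^ (-α) • G v) (Ioi 0)) :
    ∫ s in Ioi (0 : ℝ), s ^ (-1 - α) • ∫ v in Ioo (0 : ℝ) s, G v =
      α⁻¹ • ∫ v in Ioi 0, v ^ (-α) • G v := by
  set k : ℝ × ℝ → ℝ := {p | 0 < p.2 ∧ p.2 < p.1}.indicator (fun p => p.1 ^ (-1 - α)) with hk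
  have hset : MeasurableSet {p : ℝ × ℝ | 0 < p.2 ∧ p.2 < p.1} :=
    (measurableSet_lt measurable_const measurable_snd).inter
      (measurableSet_lt measurable_snd measurable_fst)
  have hkm : Measurable k := by
    refine Measurable.indicator ?_ hset
    fun_prop
  have hk0 : ∀ p, 0 ≤ k p := by
    intro p
    refine indicator_nonneg (fun p hp => ?_) p
    exact Real.rpow_nonneg (hp.1.trans hp.2).le _
  have hslice : ∀ w : ℝ, 0 < w → (fun s => k (s, w)) =
      (Ioi w).indicator fun s => s ^ (-1 - α) := by
    intro w hw; funext s; simp [hk, indicator, hw]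
  have hm : IntegrableOn (fun w => (α⁻¹ * w ^ (-α)) • G w) (Ioi 0) := by
    simp_rw [mul_smul]; exact hG.smul α⁻¹
  have := integral_kernel_swap hkm hk0 (m := fun w => α⁻¹ * w ^ (-α)) (G := G) ?_ hGm hm
  · simp_rw [mul_smul] at this
    rw [integral_smul] at this
    rw [← this]
    refine setIntegral_congr_fun measurableSet_Ioi fun s hs => ?_
    have e2 : ∫ w in Ioi (0 : ℝ), k (s, w) • G w = ∫ w in Ioo 0 s, (s ^ (-1 - α)) • G w := by
      rw [← integral_indicator measurableSet_Ioi, ← integral_indicator measurableSet_Ioo]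
      congr 1; funext w
      simp only [hk, indicator, mem_Ioi, mem_Ioo, mem_ofPred_eq]
      split_ifs <;> simp_all
    rw [e2, integral_smul]
  · intro w hw
    rw [hslice w hw, integral_indicator measurableSet_Ioi, IntegrableOn,
      integrable_indicator_iff measurableSet_Ioi, IntegrableOn,
      Measure.restrict_restrict measurableSet_Ioi,
      inter_eq_left.2 (Ioi_subset_Ioi hw.le)]
    refine ⟨integrableOn_Ioi_rpow_of_lt (by linarith) hw, ?_⟩
    rw [integral_Ioi_rpow_of_lt (by linarith) hw, show -1 - α + 1 = -α by ring]
    field_simp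

/-- For r < X only s < X - a contributes, so the kernel may be cut off there; it is then integrable,
and the claim is the convolution of two L¹ functions. -/
theorem integrable_rpow_conv {β : ℝ} (hβ : 0 < β) {F : ℝ → ℂ} {a X : ℝ} (hF0 : ∀ r ≤ a, F r = 0)
    (hF : IntegrableOn F (Iio X)) :
    Integrable (fun p : ℝ × ℝ => p.2 ^ (β - 1) • F (p.1 - p.2))
      ((volume.restrict (Iio X)).prod (volume.restrict (Ioi 0))) := by
  have hk : Integrable ((Ioo 0 (X - a)).indicator fun s : ℝ => s ^ (β - 1)) := by
    rw [integrable_indicator_iff measurableSet_Ioo]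
    by_cases h : 0 < X - a
    · exact (intervalIntegral.integrableOn_Ioo_rpow_iff h).2 (by linarith)
    · rw [Ioo_eq_empty h]; exact integrableOn_empty
  have hF' := (integrable_indicator_iff measurableSet_Iio).2 hF
  have := hk.convolution_integrand (ContinuousLinearMap.lsmul ℝ ℝ (E := ℂ)) hF'
  rw [Measure.prod_restrict]
  refine (integrableOn_congr_fun ?_ (measurableSet_Iio.prod measurableSet_Ioi)).1
    this.integrableOn
  rintro ⟨r, s⟩ ⟨hr, hs⟩
  simp only [mem_Iio, mem_Ioi] at hr hs
  have hrs : r - s < X := by linarith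
  simp only [ContinuousLinearMap.lsmul_apply, indicator, mem_Iio, mem_Ioo, hrs, hs, true_and, if_true]
  split_ifs with h
  · rfl
  · rw [hF0 (r - s) (by linarith), smul_zero, smul_zero]

theorem integral_Iio_comp_sub (F : ℝ → ℂ) (x s : ℝ) :
    ∫ r in Iio x, F (r - s) = ∫ r in Iio (x - s), F r := by
  rw [← integral_indicator measurableSet_Iio, ← integral_indicator measurableSet_Iio,
    ← integral_sub_right_eq_self (fun r => (Iio (x - s)).indicator F r) s]
  congr 1; funext w
  simp [indicator]

theorem integral_Ioi_comp_const_sub (F : ℝ → ℂ) (x : ℝ) :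
    ∫ w in Ioi 0, F (x - w) = ∫ r in Iio x, F r := by
  rw [← integral_indicator measurableSet_Iio, ← integral_indicator measurableSet_Ioi,
    ← integral_sub_left_eq_self (fun r => (Iio x).indicator F r) volume x]
  congr 1; funext w
  simp [indicator]

theorem integrableOn_Ioi_comp_const_sub {F : ℝ → ℂ} {x : ℝ} (hF : IntegrableOn F (Iio x)) :
    IntegrableOn (fun w => F (x - w)) (Ioi 0) := by
  rw [← integrable_indicator_iff measurableSet_Iio] at hF
  rw [← integrable_indicator_iff measurableSet_Ioi]
  refine (hF.comp_sub_left x).congr (Eventually.of_forall fun w => ?_)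
  simp [indicator]

/-- Equal primitives have equal derivatives, and Lebesgue differentiation recovers the integrands.
-/
theorem ae_eq_of_integral_Iio_eq {F G : ℝ → ℂ} {X : ℝ} (hF : IntegrableOn F (Iio X))
    (hG : IntegrableOn G (Iio X)) (h : ∀ x < X, ∫ r in Iio x, F r = ∫ r in Iio x, G r) :
    ∀ᵐ r ∂(volume.restrict (Iio X)), F r = G r := by
  have hF' := (integrable_indicator_iff measurableSet_Iio).2 hF
  have hG' := (integrable_indicator_iff measurableSet_Iio).2 hG
  rw [ae_restrict_iff' measurableSet_Iio]
  filter_upwards [LocallyIntegrable.ae_hasDerivAt_integral hF'.locallyIntegrable,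
    LocallyIntegrable.ae_hasDerivAt_integral hG'.locallyIntegrable] with x hx hx' hxX
  have hxX : x < X := hxX
  have key : ∀ (K : ℝ → ℂ), IntegrableOn K (Iio X) → ∀ y < X,
      ∫ t in x..y, (Iio X).indicator K t = (∫ t in Iio y, K t) - ∫ t in Iio x, K t := by
    intro K hK y hy
    rw [← integral_Iic_eq_integral_Iio, ← integral_Iic_eq_integral_Iio,
      intervalIntegral.integral_Iic_sub_Iic (hK.mono_set (Iic_subset_Iio.2 hxX))
        (hK.mono_set (Iic_subset_Iio.2 hy))]
    refine intervalIntegral.integral_congr fun t ht => ?_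
    have : t < X := lt_of_le_of_lt ht.2 (max_lt hxX hy)
    simp [indicator, this]
  have e1 : (fun y => ∫ t in x..y, (Iio X).indicator F t) =ᶠ[𝓝 x]
      fun y => ∫ t in x..y, (Iio X).indicator G t := by
    filter_upwards [Iio_mem_nhds hxX] with y hy
    rw [key F hF y hy, key G hG y hy, h y hy, h x hxX]
  have := (hx x).unique ((hx' x).congr_of_eventuallyEq e1)
  simpa [indicator, hxX] using this

/-- The Marchaud fractional derivative, up to a constant factor. -/
noncomputable def marchaud (α : ℝ) (F : ℝ → ℂ) (r : ℝ) : ℂ :=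
  ∫ s in Ioi (0 : ℝ), s ^ (-1 - α) • (F r - F (r - s))

theorem marchaud_eq_zero {α : ℝ} {F : ℝ → ℂ} {a : ℝ} (hF0 : ∀ r ≤ a, F r = 0) {r : ℝ} (hr : r ≤ a) :
    marchaud α F r = 0 := by
  unfold marchaud
  rw [setIntegral_congr_fun (g := fun _ => (0 : ℂ)) measurableSet_Ioi]
  · simp
  · intro s hs
    have hs : 0 < s := hs
    simp [hF0 r hr, hF0 (r - s) (by linarith)]

variable {α a X : ℝ} {F : ℝ → ℂ}

/-- Almost every slice in s is integrable. For one such s > X - a the shifted term vanishes on r <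
X, and the slice is a nonzero multiple of F. -/
theorem integrableOn_of_marchaud (hF0 : ∀ r ≤ a, F r = 0)
    (hint : Integrable (fun p : ℝ × ℝ => p.2 ^ (-1 - α) • (F p.1 - F (p.1 - p.2)))
      ((volume.restrict (Iio X)).prod (volume.restrict (Ioi 0)))) :
    IntegrableOn F (Iio X) := by
  have h1 : ∀ᵐ s ∂(volume.restrict (Ioi (max 0 (X - a)))),
      Integrable (fun r => s ^ (-1 - α) • (F r - F (r - s))) (volume.restrict (Iio X)) :=
    ae_mono (Measure.restrict_mono (Ioi_subset_Ioi (le_max_left _ _)) le_rfl) hint.prod_left_ae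
  have : NeBot (ae (volume.restrict (Ioi (max 0 (X - a))))) := by
    rw [ae_neBot]; intro h
    rw [Measure.restrict_eq_zero] at h
    simp at h
  obtain ⟨s, hs, hsi⟩ := ((ae_restrict_mem measurableSet_Ioi).and h1).exists
  rw [mem_Ioi, max_lt_iff] at hs
  have hp : s ^ (-1 - α) ≠ 0 := (Real.rpow_pos_of_pos hs.1 _).ne'
  have h2 := hsi.smul (s ^ (-1 - α))⁻¹
  refine (integrableOn_congr_fun (fun r hr => ?_) measurableSet_Iio).1 h2
  have hr : r < X := hr
  simp [hp, hF0 (r - s) (by linarith [hs.2])]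

/-- For fixed s, the integral of F(r) - F(r-s) over r < x telescopes to the integral of F over (x-s,
x). -/
theorem integral_marchaud (hF0 : ∀ r ≤ a, F r = 0)
    (hint : Integrable (fun p : ℝ × ℝ => p.2 ^ (-1 - α) • (F p.1 - F (p.1 - p.2)))
      ((volume.restrict (Iio X)).prod (volume.restrict (Ioi 0)))) {x : ℝ} (hx : x ≤ X) :
    ∫ r in Iio x, marchaud α F r = ∫ s in Ioi (0 : ℝ), s ^ (-1 - α) • ∫ v in Ioo 0 s, F (x - v) := by
  have hF := integrableOn_of_marchaud hF0 hint
  have hFx := hF.mono_set (Iio_subset_Iio hx)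
  have hint' : Integrable (fun p : ℝ × ℝ => p.2 ^ (-1 - α) • (F p.1 - F (p.1 - p.2)))
      ((volume.restrict (Iio x)).prod (volume.restrict (Ioi 0))) := by
    rw [Measure.prod_restrict] at hint ⊢
    exact IntegrableOn.mono_set hint (prod_mono (Iio_subset_Iio hx) le_rfl)
  unfold marchaud
  rw [integral_integral_swap hint']
  refine setIntegral_congr_fun measurableSet_Ioi fun s hs => ?_
  have hs : 0 < s := hs
  have hFxs : IntegrableOn (fun r => F (r - s)) (Iio x) := by
    have := (integrable_indicator_iff measurableSet_Iio).2
      (hFx.mono_set (Iio_subset_Iio (show x - s ≤ x by linarith)))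
    rw [← integrable_indicator_iff measurableSet_Iio]
    refine (this.comp_sub_right s).congr (Eventually.of_forall fun w => ?_)
    simp [indicator]
  rw [integral_smul, integral_sub hFx hFxs, integral_Iio_comp_sub]
  congr 1
  rw [← integral_Ioc_eq_integral_Ioo, ← intervalIntegral.integral_of_le hs.le,
    intervalIntegral.integral_comp_sub_left, sub_zero, ← integral_Iic_eq_integral_Iio,
    ← integral_Iic_eq_integral_Iio, intervalIntegral.integral_Iic_sub_Iic]
  · rw [integrableOn_Iic_iff_integrableOn_Iio]
    exact hFx.mono_set (Iio_subset_Iio (by linarith))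
  · rwa [integrableOn_Iic_iff_integrableOn_Iio]

/-- The fractional integral inverts the Marchaud derivative. -/
theorem marchaud_inversion (h0 : 0 < α) (h1 : α < 1) (hF0 : ∀ r ≤ a, F r = 0)
    (hint : Integrable (fun p : ℝ × ℝ => p.2 ^ (-1 - α) • (F p.1 - F (p.1 - p.2)))
      ((volume.restrict (Iio X)).prod (volume.restrict (Ioi 0)))) :
    ∀ᵐ r ∂(volume.restrict (Iio X)),
      IntegrableOn (fun s => s ^ (α - 1) • marchaud α F (r - s)) (Ioi 0) ∧
      ∫ s in Ioi (0 : ℝ), s ^ (α - 1) • marchaud α F (r - s) = (α⁻¹ * betaConst α) • F r := by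
  have hF := integrableOn_of_marchaud hF0 hint
  have hH : IntegrableOn (marchaud α F) (Iio X) := hint.integral_prod_left
  have hHc := integrable_rpow_conv h0 (fun r hr => marchaud_eq_zero (α := α) hF0 hr) hH
  have hFc := integrable_rpow_conv (β := 1 - α) (by linarith) hF0 hF
  -- The primitive of the Marchaud derivative is, up to a factor, the fractional integral of F of
  -- order 1-α.
  have hprim : ∀ᵐ y ∂(volume.restrict (Iio X)), ∫ r in Iio y, marchaud α F r =
      α⁻¹ • ∫ v in Ioi (0 : ℝ), v ^ (-α) • F (y - v) := by
    filter_upwards [hFc.prod_right_ae, ae_restrict_mem measurableSet_Iio] with y hy hyX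
    have hyX : y < X := hyX
    rw [integral_marchaud hF0 hint hyX.le, integral_rpow_primitive h0]
    · exact (integrableOn_Ioi_comp_const_sub (hF.mono_set (Iio_subset_Iio hyX.le))).1
    · rw [show 1 - α - 1 = -α by ring] at hy
      exact hy
  -- The two sides are compared through their primitives, where the semigroup law applies.
  have hae := ae_eq_of_integral_Iio_eq (X := X) (F := fun r => ∫ s in Ioi (0 : ℝ), s ^ (α - 1) •
    marchaud α F (r - s)) (G := fun r => (α⁻¹ * betaConst α) • F r) hHc.integral_prod_left
    (Integrable.smul (α⁻¹ * betaConst α) hF) ?_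
  · filter_upwards [hae, hHc.prod_right_ae] with r h1 h2
    exact ⟨h2, h1⟩
  · intro x hx
    have hHcx : Integrable (fun p : ℝ × ℝ => p.2 ^ (α - 1) • marchaud α F (p.1 - p.2))
        ((volume.restrict (Iio x)).prod (volume.restrict (Ioi 0))) := by
      rw [Measure.prod_restrict] at hHc ⊢
      exact IntegrableOn.mono_set hHc (prod_mono (Iio_subset_Iio hx.le) le_rfl)
    rw [integral_integral_swap hHcx, integral_smul, ← integral_Ioi_comp_const_sub F, mul_smul,
      ← integral_rpow_conv_shift h0 h1
        (integrableOn_Ioi_comp_const_sub (hF.mono_set (Iio_subset_Iio hx.le))), ← integral_smul]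
    refine integral_congr_ae ?_
    -- `hprim` holds for almost every endpoint only; s ↦ x - s preserves null sets.
    have hq : ∀ᵐ s ∂(volume.restrict (Ioi (0 : ℝ))), ∫ r in Iio (x - s), marchaud α F r =
        α⁻¹ • ∫ v in Ioi (0 : ℝ), v ^ (-α) • F (x - s - v) := by
      rw [ae_restrict_iff' measurableSet_Iio] at hprim
      rw [ae_restrict_iff' measurableSet_Ioi]
      have hqm : Measure.QuasiMeasurePreserving (fun s : ℝ => x - s) volume volume :=
        (volume.measurePreserving_sub_left x).quasiMeasurePreserving
      filter_upwards [hqm.ae hprim] with s hs hs0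
      have hs0 : 0 < s := hs0
      exact hs (show x - s < X by linarith)
    filter_upwards [hq] with s hs
    rw [integral_smul, integral_Iio_comp_sub, hs, smul_comm]
    simp only [sub_sub]

end Line

/-! ### The `L₂`-norm of nonnegative functions -/

section L2

variable {X T : Type*} [MeasurableSpace X] [MeasurableSpace T] {μ : Measure X} {ν : Measure T}

/-- The `L₂`-norm of a function with values in `[0, ∞]`. -/
noncomputable def l2n (μ : Measure X) (h : X → ℝ≥0∞) : ℝ≥0∞ := (∫⁻ x, h x ^ (2 : ℝ) ∂μ) ^ (1 / 2 : ℝ)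

theorem l2n_rpow (h : X → ℝ≥0∞) : l2n μ h ^ (2 : ℝ) = ∫⁻ x, h x ^ (2 : ℝ) ∂μ := by
  rw [l2n, ← ENNReal.rpow_mul]; norm_num

theorem l2n_le_iff {h : X → ℝ≥0∞} {C : ℝ≥0∞} :
    l2n μ h ≤ C ↔ ∫⁻ x, h x ^ (2 : ℝ) ∂μ ≤ C ^ (2 : ℝ) := by
  rw [← l2n_rpow, ENNReal.rpow_le_rpow_iff (by norm_num)]

theorem l2n_mono_ae {g h : X → ℝ≥0∞} (hgh : ∀ᵐ x ∂μ, g x ≤ h x) : l2n μ g ≤ l2n μ h := by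
  refine ENNReal.rpow_le_rpow (lintegral_mono_ae ?_) (by norm_num)
  filter_upwards [hgh] with x hx
  exact ENNReal.rpow_le_rpow hx (by norm_num)

theorem l2n_mono {g h : X → ℝ≥0∞} (hgh : ∀ x, g x ≤ h x) : l2n μ g ≤ l2n μ h :=
  l2n_mono_ae (Eventually.of_forall hgh)

theorem l2n_add_le {g h : X → ℝ≥0∞} (hg : AEMeasurable g μ) (hh : AEMeasurable h μ) :
    l2n μ (fun x => g x + h x) ≤ l2n μ g + l2n μ h :=
  ENNReal.lintegral_Lp_add_le hg hh (by norm_num)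

theorem l2n_const_mul {c : ℝ≥0∞} {h : X → ℝ≥0∞} (hh : Measurable h) :
    l2n μ (fun x => c * h x) = c * l2n μ h := by
  simp only [l2n, ENNReal.mul_rpow_of_nonneg _ _ (show (0 : ℝ) ≤ 2 by norm_num)]
  rw [lintegral_const_mul _ (by fun_prop), ENNReal.mul_rpow_of_nonneg _ _ (by norm_num),
    ← ENNReal.rpow_mul]
  norm_num

theorem l2n_sum_le {ι : Type*} (s : Finset ι) {h : ι → X → ℝ≥0∞} (hh : ∀ i, Measurable (h i)) :
    l2n μ (fun x => ∑ i ∈ s, h i x) ≤ ∑ i ∈ s, l2n μ (h i) := by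
  classical
  induction s using Finset.induction_on with
  | empty => simp [l2n]
  | insert i s hi ih =>
    simp only [Finset.sum_insert hi]
    exact (l2n_add_le (hh i).aemeasurable (Finset.measurable_fun_sum s fun i _ => hh i).aemeasurable).trans
      (add_le_add le_rfl ih)

theorem lintegral_mul_le_l2n {g h : X → ℝ≥0∞} (hg : AEMeasurable g μ) (hh : AEMeasurable h μ) :
    ∫⁻ x, g x * h x ∂μ ≤ l2n μ g * l2n μ h :=
  ENNReal.lintegral_mul_le_Lp_mul_Lq μ (Real.HolderConjugate.two_two) hg hh

theorem l2n_eq_eLpNorm {F : Type*} [NormedAddCommGroup F] (f : X → F) :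
    l2n μ (fun x => ‖f x‖ₑ) = eLpNorm f 2 μ := by
  rw [eLpNorm_eq_lintegral_rpow_enorm_toReal (by norm_num) (by norm_num), l2n]
  norm_num

/-- Minkowski's integral inequality in `L₂`. -/
theorem l2n_lintegral_le [SFinite μ] [SFinite ν] {h : X → T → ℝ≥0∞}
    (hh : Measurable (Function.uncurry h)) :
    l2n μ (fun x => ∫⁻ t, h x t ∂ν) ≤ ∫⁻ t, l2n μ (fun x => h x t) ∂ν := by
  have hm1 : ∀ x, Measurable (h x) := fun x => hh.comp (measurable_const.prodMk measurable_id)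
  have hm2 : ∀ t, Measurable (fun x => h x t) := fun t => hh.comp (measurable_id.prodMk measurable_const)
  have hl : Measurable fun t => l2n μ (fun x => h x t) := by
    refine Measurable.pow_const ?_ _
    exact Measurable.lintegral_prod_left (f := fun x t => h x t ^ (2 : ℝ))
      (hh.pow_const 2)
  rw [l2n_le_iff]
  -- The square is expanded into a double integral over t and t', and Cauchy–Schwarz in x is applied
  -- to each pair.
  calc ∫⁻ x, (∫⁻ t, h x t ∂ν) ^ (2 : ℝ) ∂μ
      = ∫⁻ x, ∫⁻ t, ∫⁻ t', h x t * h x t' ∂ν ∂ν ∂μ := by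
        refine lintegral_congr fun x => ?_
        rw [ENNReal.rpow_two, sq, ← lintegral_mul_const _ (hm1 x)]
        refine lintegral_congr fun t => ?_
        rw [lintegral_const_mul _ (hm1 x)]
    _ = ∫⁻ t, ∫⁻ x, ∫⁻ t', h x t * h x t' ∂ν ∂μ ∂ν := by
        rw [lintegral_lintegral_swap]
        refine Measurable.aemeasurable ?_
        refine Measurable.lintegral_prod_right' (f := fun q : (X × T) × T => h q.1.1 q.1.2 * h q.1.1 q.2) ?_
        exact (hh.comp (by fun_prop : Measurable fun q : (X × T) × T => (q.1.1, q.1.2))).mul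
          (hh.comp (by fun_prop : Measurable fun q : (X × T) × T => (q.1.1, q.2)))
    _ = ∫⁻ t, ∫⁻ t', ∫⁻ x, h x t * h x t' ∂μ ∂ν ∂ν := by
        refine lintegral_congr fun t => ?_
        rw [lintegral_lintegral_swap]
        exact (((hm2 t).comp measurable_fst).mul hh).aemeasurable
    _ ≤ ∫⁻ t, ∫⁻ t', l2n μ (fun x => h x t) * l2n μ (fun x => h x t') ∂ν ∂ν :=
        lintegral_mono fun t => lintegral_mono fun t' =>
          lintegral_mul_le_l2n (hm2 t).aemeasurable (hm2 t').aemeasurable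
    _ = (∫⁻ t, l2n μ (fun x => h x t) ∂ν) ^ (2 : ℝ) := by
        rw [ENNReal.rpow_two, sq, ← lintegral_mul_const _ hl]
        refine lintegral_congr fun t => ?_
        rw [lintegral_const_mul _ hl]

/-- Fatou's lemma; this carries the weighted bounds from test functions to limits. -/
theorem l2n_le_of_tendsto {h : ℕ → X → ℝ≥0∞} {g : X → ℝ≥0∞} (hh : ∀ k, Measurable (h k))
    (hlim : ∀ᵐ x ∂μ, Tendsto (fun k => h k x) atTop (𝓝 (g x))) {C : ℝ≥0∞}
    (hC : ∀ᶠ k in atTop, l2n μ (h k) ≤ C) : l2n μ g ≤ C := by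
  rw [l2n_le_iff]
  calc ∫⁻ x, g x ^ (2 : ℝ) ∂μ ≤ ∫⁻ x, liminf (fun k => h k x ^ (2 : ℝ)) atTop ∂μ := by
        refine lintegral_mono_ae ?_
        filter_upwards [hlim] with x hx
        rw [(hx.ennrpow_const 2).liminf_eq]
    _ ≤ liminf (fun k => ∫⁻ x, h k x ^ (2 : ℝ) ∂μ) atTop :=
        lintegral_liminf_le fun k => (hh k).pow_const _
    _ ≤ C ^ (2 : ℝ) := by
        refine liminf_le_of_frequently_le' (Eventually.frequently ?_)
        filter_upwards [hC] with k hk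
        exact l2n_le_iff.1 hk

theorem ae_lt_top_of_l2n {h : X → ℝ≥0∞} (hh : Measurable h) (hfin : l2n μ h ≠ ⊤) :
    ∀ᵐ x ∂μ, h x < ⊤ := by
  have : ∫⁻ x, h x ^ (2 : ℝ) ∂μ ≠ ⊤ := by
    rw [← l2n_rpow]; exact ENNReal.rpow_ne_top_of_nonneg zero_le_two hfin
  filter_upwards [ae_lt_top (hh.pow_const _) this] with x hx
  by_contra hc
  rw [not_lt_top_iff] at hc
  simp [hc] at hx

end L2

/-! ### Dilations and radial weights -/

section Dilation

variable {n : ℕ}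

theorem lintegral_comp_smul {h : E n → ℝ≥0∞} (hh : Measurable h) {t : ℝ} (ht : 0 < t) :
    ∫⁻ w, h (t • w) = ENNReal.ofReal (t ^ (-(n : ℝ))) * ∫⁻ w, h w := by
  rw [← lintegral_map (μ := volume) (g := fun w : E n => t • w) hh (by fun_prop),
    Measure.map_addHaar_smul _ ht.ne', lintegral_smul_measure, finrank_euclideanSpace_fin,
    abs_of_pos (by positivity), Real.rpow_neg ht.le, Real.rpow_natCast, smul_eq_mul]

theorem l2n_comp_smul {h : E n → ℝ≥0∞} (hh : Measurable h) {t : ℝ} (ht : 0 < t) :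
    l2n volume (fun w => h (t • w)) = ENNReal.ofReal (t ^ (-(n : ℝ) / 2)) * l2n volume h := by
  rw [l2n, lintegral_comp_smul (hh.pow_const 2) ht, ENNReal.mul_rpow_of_nonneg _ _ (by norm_num),
    ENNReal.ofReal_rpow_of_nonneg (by positivity) (by norm_num), ← Real.rpow_mul ht.le, l2n]
  ring_nf

/-- The function `|w|^{-β} |u(w)|`. -/
noncomputable def wt (β : ℝ) (u : E n → ℂ) (w : E n) : ℝ≥0∞ := ENNReal.ofReal (‖w‖ ^ (-β)) * ‖u w‖ₑ

theorem measurable_wt {β : ℝ} {u : E n → ℂ} (hu : Measurable u) : Measurable (wt β u) := by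
  unfold wt; fun_prop

theorem wt_comp_smul (β : ℝ) (u : E n → ℂ) {t : ℝ} (ht : 0 < t) (w : E n) :
    wt β (fun w => u (t • w)) w = ENNReal.ofReal (t ^ β) * wt β u (t • w) := by
  unfold wt
  rw [norm_smul, Real.norm_of_nonneg ht.le, Real.mul_rpow ht.le (norm_nonneg _),
    Real.rpow_neg ht.le, ← mul_assoc, ← ENNReal.ofReal_mul (by positivity)]
  congr 2
  have : t ^ β ≠ 0 := (Real.rpow_pos_of_pos ht _).ne'
  field_simp

theorem wt_add_le (β : ℝ) (u v : E n → ℂ) (w : E n) :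
    wt β (fun w => u w + v w) w ≤ wt β u w + wt β v w := by
  unfold wt
  rw [← mul_add]
  gcongr
  exact enorm_add_le _ _

theorem wt_sub_le (β : ℝ) (u v : E n → ℂ) (w : E n) :
    wt β (fun w => u w - v w) w ≤ wt β u w + wt β v w := by
  unfold wt
  rw [← mul_add]
  gcongr
  exact enorm_sub_le

/-- The weighted norm `‖|w|^{-β} u‖`. -/
noncomputable def wn (β : ℝ) (u : E n → ℂ) : ℝ≥0∞ := l2n volume (wt β u)

theorem wn_add_le {β : ℝ} {u v : E n → ℂ} (hu : Measurable u) (hv : Measurable v) :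
    wn β (fun w => u w + v w) ≤ wn β u + wn β v :=
  (l2n_mono (wt_add_le β u v)).trans
    (l2n_add_le (measurable_wt hu).aemeasurable (measurable_wt hv).aemeasurable)

theorem wn_sub_le {β : ℝ} {u v : E n → ℂ} (hu : Measurable u) (hv : Measurable v) :
    wn β (fun w => u w - v w) ≤ wn β u + wn β v :=
  (l2n_mono (wt_sub_le β u v)).trans
    (l2n_add_le (measurable_wt hu).aemeasurable (measurable_wt hv).aemeasurable)

theorem wn_comp_smul {β : ℝ} {u : E n → ℂ} (hu : Measurable u) {t : ℝ} (ht : 0 < t) :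
    wn β (fun w => u (t • w)) = ENNReal.ofReal (t ^ (β - (n : ℝ) / 2)) * wn β u := by
  have hm : Measurable fun w : E n => wt β u (t • w) := (measurable_wt hu).comp (by fun_prop)
  rw [wn, show wt β (fun w => u (t • w)) = fun w => ENNReal.ofReal (t ^ β) * wt β u (t • w) from
    funext (wt_comp_smul β u ht), l2n_const_mul hm, l2n_comp_smul (measurable_wt hu) ht, ← mul_assoc,
    ← ENNReal.ofReal_mul (by positivity), ← Real.rpow_add ht, wn]
  ring_nf

end Dilation

/-! ### Bounds for smooth functions vanishing near the origin -/

section Smooth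

variable {n : ℕ} {φ : E n → ℂ} {S : E n → ℝ≥0∞} {R β : ℝ}

theorem enorm_sub_smul_le (hφ : ContDiff ℝ 1 φ) (hS : Measurable S)
    (hSφ : ∀ w v, ‖fderiv ℝ φ w v‖ₑ ≤ S w * ‖v‖ₑ) {τ : ℝ} (hτ : 1 ≤ τ) (w : E n) :
    ‖φ w - φ (τ • w)‖ₑ ≤ ‖w‖ₑ * ∫⁻ σ in Ioc 1 τ, S (σ • w) := by
  have hd : ∀ σ ∈ uIcc 1 τ, HasDerivAt (fun σ : ℝ => φ (σ • w)) (fderiv ℝ φ (σ • w) w) σ := by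
    intro σ _
    have h1 : HasDerivAt (fun σ : ℝ => σ • w) w σ := by
      simpa using (hasDerivAt_id σ).smul_const w
    exact ((hφ.differentiable one_ne_zero _).hasFDerivAt).comp_hasDerivAt σ h1
  have hc : Continuous fun σ : ℝ => fderiv ℝ φ (σ • w) w :=
    ((hφ.continuous_fderiv one_ne_zero).comp (by fun_prop)).clm_apply continuous_const
  have := intervalIntegral.integral_eq_sub_of_hasDerivAt hd (hc.intervalIntegrable _ _)
  rw [one_smul] at this
  rw [← enorm_neg, neg_sub, ← this, intervalIntegral.integral_of_le hτ]
  refine (enorm_integral_le_lintegral_enorm _).trans ?_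
  have hm : Measurable fun σ : ℝ => S (σ • w) := hS.comp (by fun_prop)
  rw [← lintegral_const_mul _ hm]
  refine lintegral_mono fun σ => ?_
  rw [mul_comm]; exact hSφ _ _

/-- The derivative of σ ↦ φ(σw) supplies a factor |w|, and |w|^(1-β) is bounded on the support since
β < 1. Minkowski in σ finishes, because dilation by σ ≥ 1 does not increase the L₂-norm. -/
theorem wn_sub_smul_le (hφ : ContDiff ℝ 1 φ) (hS : Measurable S)
    (hSφ : ∀ w v, ‖fderiv ℝ φ w v‖ₑ ≤ S w * ‖v‖ₑ) (hR : ∀ w, φ w ≠ 0 → ‖w‖ ≤ R) (hR0 : 0 ≤ R)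
    (hβ : β < 1) {τ : ℝ} (hτ : 1 ≤ τ) :
    wn β (fun w => φ w - φ (τ • w)) ≤
      ENNReal.ofReal (R ^ (1 - β)) * (ENNReal.ofReal (τ - 1) * l2n volume S) := by
  have hm : Measurable (Function.uncurry fun (w : E n) (σ : ℝ) => S (σ • w)) :=
    hS.comp (by fun_prop : Measurable fun p : E n × ℝ => p.2 • p.1)
  have hpt : ∀ w, wt β (fun w => φ w - φ (τ • w)) w ≤
      ENNReal.ofReal (R ^ (1 - β)) * ∫⁻ σ in Ioc 1 τ, S (σ • w) := by
    intro w
    unfold wt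
    by_cases hw : ‖w‖ ≤ R
    · rcases eq_or_ne w 0 with rfl | hw0
      · simp
      have hwp : 0 < ‖w‖ := norm_pos_iff.2 hw0
      calc _ ≤ ENNReal.ofReal (‖w‖ ^ (-β)) * (‖w‖ₑ * ∫⁻ σ in Ioc 1 τ, S (σ • w)) := by
            gcongr; exact enorm_sub_smul_le hφ hS hSφ hτ w
        _ = ENNReal.ofReal (‖w‖ ^ (1 - β)) * ∫⁻ σ in Ioc 1 τ, S (σ • w) := by
            rw [← mul_assoc, ← ofReal_norm, ← ENNReal.ofReal_mul (by positivity),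
              ← Real.rpow_add_one hwp.ne', show -β + 1 = 1 - β by ring]
        _ ≤ _ := by
            gcongr
    · have h1 : φ w = 0 := by by_contra h; exact hw (hR w h)
      have h2 : φ (τ • w) = 0 := by
        by_contra h
        have := hR _ h
        rw [norm_smul, Real.norm_of_nonneg (by linarith)] at this
        nlinarith [norm_nonneg w]
      simp [h1, h2]
  calc _ ≤ l2n volume fun w => ENNReal.ofReal (R ^ (1 - β)) * ∫⁻ σ in Ioc 1 τ, S (σ • w) :=
        l2n_mono hpt
    _ = ENNReal.ofReal (R ^ (1 - β)) * l2n volume fun w => ∫⁻ σ in Ioc 1 τ, S (σ • w) :=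
        l2n_const_mul hm.lintegral_prod_right
    _ ≤ _ := by
        gcongr
        refine (l2n_lintegral_le hm).trans ?_
        calc ∫⁻ σ in Ioc 1 τ, l2n volume (fun w => S (σ • w)) ≤ ∫⁻ σ in Ioc 1 τ, l2n volume S := by
              refine setLIntegral_mono measurable_const fun σ hσ => ?_
              rw [l2n_comp_smul hS (by linarith [hσ.1])]
              refine mul_le_of_le_one_left zero_le ?_
              rw [ENNReal.ofReal_le_one]
              refine Real.rpow_le_one_of_one_le_of_nonpos hσ.1.le ?_
              have : (0 : ℝ) ≤ n := n.cast_nonneg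
              linarith
          _ = _ := by simp [mul_comm]

theorem wn_lt_top (hφ : Continuous φ) (hc : HasCompactSupport φ) (h0 : (0 : E n) ∉ tsupport φ)
    (hβ : 0 ≤ β) : wn β φ ≠ ⊤ := by
  obtain ⟨δ, hδ, hb⟩ := Metric.isOpen_iff.1 (isClosed_tsupport φ).isOpen_compl 0 h0
  have hpt : ∀ w, wt β φ w ≤ ENNReal.ofReal (δ ^ (-β)) * ‖φ w‖ₑ := by
    intro w
    unfold wt
    by_cases hw : φ w = 0
    · simp [hw]
    · have : δ ≤ ‖w‖ := by
        by_contra hlt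
        exact hb (by simpa using hlt) (subset_tsupport _ hw)
      gcongr ENNReal.ofReal ?_ * _
      exact Real.rpow_le_rpow_of_nonpos hδ this (by linarith)
  refine ne_top_of_le_ne_top ?_ (l2n_mono hpt)
  rw [l2n_const_mul hφ.measurable.enorm, l2n_eq_eLpNorm]
  exact ENNReal.mul_ne_top ENNReal.ofReal_ne_top (hφ.memLp_of_hasCompactSupport hc).2.ne

/-- Dilation by 2 multiplies the weighted norm by exactly 2^(β-n/2), so the triangle inequality,
used in both directions, bounds u by its dilation difference. Finiteness is what allows the norm to
be subtracted. -/
theorem abs_one_sub_mul_wn_le {u : E n → ℂ} (hu : Measurable u) (hfin : wn β u ≠ ⊤) :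
    ENNReal.ofReal |1 - (2 : ℝ) ^ (β - (n : ℝ) / 2)| * wn β u ≤
      wn β (fun w => u w - u ((2 : ℝ) • w)) := by
  set κ : ℝ := (2 : ℝ) ^ (β - (n : ℝ) / 2) with hκ
  have hκ0 : 0 ≤ κ := by positivity
  have hu2 : Measurable fun w : E n => u ((2 : ℝ) • w) := hu.comp (by fun_prop)
  have hs : wn β (fun w => u ((2 : ℝ) • w)) = ENNReal.ofReal κ * wn β u := wn_comp_smul hu two_pos
  set D := wn β (fun w => u w - u ((2 : ℝ) • w)) with hD
  have t1 : wn β u ≤ D + ENNReal.ofReal κ * wn β u := by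
    rw [← hs]
    have := wn_add_le (β := β) (u := fun w => u w - u ((2 : ℝ) • w)) (hu.sub hu2) hu2
    simpa only [sub_add_cancel] using this
  have t2 : ENNReal.ofReal κ * wn β u ≤ wn β u + D := by
    rw [← hs]
    have := wn_sub_le (β := β) (v := fun w => u w - u ((2 : ℝ) • w)) hu (hu.sub hu2)
    simpa only [sub_sub_cancel] using this
  rcases eq_or_ne D ⊤ with hDt | hDt
  · simp [hDt]
  lift D to ℝ≥0 using hDt with D'
  lift wn β u to ℝ≥0 using hfin with W
  unfold ENNReal.ofReal at t1 t2 ⊢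
  norm_cast at t1 t2 ⊢
  rw [← NNReal.coe_le_coe] at t1 t2 ⊢
  push_cast at t1 t2 ⊢
  rw [Real.coe_toNNReal _ hκ0] at t1 t2
  rw [Real.coe_toNNReal _ (abs_nonneg _)]
  rcases abs_cases (1 - κ) with ⟨h, _⟩ | ⟨h, _⟩ <;> rw [h] <;> nlinarith

theorem wn_le_of_le {α : ℝ} {u : E n → ℂ} (hu : Measurable u) (hα : 0 < α) (hαβ : α ≤ β) (hR0 : 0 ≤ R)
    (hR : ∀ w, u w ≠ 0 → ‖w‖ ≤ R) : wn α u ≤ ENNReal.ofReal (R ^ (β - α)) * wn β u := by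
  rw [wn, wn, ← l2n_const_mul (measurable_wt hu)]
  refine l2n_mono_ae ?_
  filter_upwards [] with w
  unfold wt
  by_cases hw : u w = 0
  · simp [hw]
  rcases eq_or_ne w 0 with rfl | hw0
  -- At the origin the weight takes the default value 0^(-α) = 0, as α ≠ 0.
  · simp [Real.zero_rpow (neg_ne_zero.2 hα.ne')]
  have hwp : 0 < ‖w‖ := norm_pos_iff.2 hw0
  rw [← mul_assoc, ← ENNReal.ofReal_mul (by positivity)]
  gcongr
  calc ‖w‖ ^ (-α) = ‖w‖ ^ (β - α) * ‖w‖ ^ (-β) := by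
        rw [← Real.rpow_add hwp]; ring_nf
    _ ≤ _ := by
        gcongr ?_ * _
        exact Real.rpow_le_rpow (norm_nonneg _) (hR w hw) (by linarith)

/-- Hardy's inequality for smooth functions vanishing near the origin. -/
theorem exists_wn_le (n : ℕ) {α : ℝ} (h0 : 0 < α) (h1 : α < 1) (R : ℝ) (hR0 : 0 ≤ R) :
    ∃ C : ℝ≥0, ∀ (φ : E n → ℂ) (S : E n → ℝ≥0∞), ContDiff ℝ 1 φ → HasCompactSupport φ →
      (0 : E n) ∉ tsupport φ → Measurable S → (∀ w v, ‖fderiv ℝ φ w v‖ₑ ≤ S w * ‖v‖ₑ) →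
      (∀ w, φ w ≠ 0 → ‖w‖ ≤ R) → wn α φ ≤ C * l2n volume S := by
  -- Hardy's inequality degenerates when n = 2β. Here α < β < 1, and 2β = 1 + α lies strictly
  -- between 1 and 2, so it is never the integer n and the factor 1 - κ is nonzero.
  set β := (1 + α) / 2 with hβ
  set κ : ℝ := (2 : ℝ) ^ (β - (n : ℝ) / 2) with hκ
  have hκ1 : 0 < |1 - κ| := by
    rw [abs_pos, sub_ne_zero]
    intro h
    have h2 : β - (n : ℝ) / 2 = 0 := by
      by_contra h3
      rcases lt_or_gt_of_ne h3 with h4 | h4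
      · exact absurd h.symm (Real.rpow_lt_one_of_one_lt_of_neg one_lt_two h4).ne
      · exact absurd h.symm (Real.one_lt_rpow one_lt_two h4).ne'
    have h3 : (n : ℝ) = 1 + α := by rw [hβ] at h2; linarith
    have h4 : (1 : ℝ) < n := by linarith
    have h5 : (n : ℝ) < 2 := by linarith
    norm_cast at h4 h5
    omega
  refine ⟨(R ^ (β - α)).toNNReal * ((|1 - κ|⁻¹).toNNReal * (R ^ (1 - β)).toNNReal), ?_⟩
  intro φ S hφ hc h0t hS hSφ hR
  have hm := hφ.continuous.measurable
  have hfin : wn β φ ≠ ⊤ := wn_lt_top hφ.continuous hc h0t (by linarith)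
  have b1 := wn_le_of_le hm h0 (show α ≤ β by linarith) hR0 hR
  have b2 := (abs_one_sub_mul_wn_le hm hfin).trans
    (wn_sub_smul_le hφ hS hSφ hR hR0 (show β < 1 by linarith) one_le_two)
  have b3 : wn β φ ≤ ENNReal.ofReal |1 - κ|⁻¹ * (ENNReal.ofReal (R ^ (1 - β)) * l2n volume S) := by
    rw [ENNReal.ofReal_inv_of_pos hκ1, ← ENNReal.mul_le_iff_le_inv]
    · convert! b2 using 2
      norm_num
    · simpa using hκ1
    · simp
  refine b1.trans ((mul_le_mul' le_rfl b3).trans (le_of_eq ?_))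
  push_cast
  simp only [ENNReal.ofReal]
  ring

end Smooth

/-! ### Weighted bounds for functions in `H₀¹` and their products with Hölder functions -/

section Sobolev

variable {n : ℕ} {Ω : Set (E n)} {P : E n} {R α : ℝ}

theorem enorm_fderiv_le_sum (φ : E n → ℂ) (x v : E n) :
    ‖fderiv ℝ φ x v‖ₑ ≤ (∑ i, ‖partialDeriv i φ x‖ₑ) * ‖v‖ₑ := by
  have hv : v = ∑ i, v i • EuclideanSpace.single i (1 : ℝ) := by
    have := (EuclideanSpace.basisFun (Fin n) ℝ).sum_repr v
    simpa using this.symm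
  conv_lhs => rw [hv, map_sum]
  refine (enorm_sum_le _ _).trans ?_
  rw [Finset.sum_mul]
  refine Finset.sum_le_sum fun i _ => ?_
  rw [map_smul, enorm_smul, mul_comm]
  unfold partialDeriv
  gcongr
  rw [enorm_le_iff_norm_le]
  exact PiLp.norm_apply_le v i

theorem partialDeriv_eq_zero {φ : E n → ℂ} (hφ : IsTest Ω φ) (i : Fin n) {x : E n} (hx : x ∉ Ω) :
    partialDeriv i φ x = 0 := by
  unfold partialDeriv
  rw [fderiv_of_notMem_tsupport (𝕜 := ℝ) (fun h => hx (hφ.support_subset h))]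
  simp

theorem IsTest.eq_zero {φ : E n → ℂ} (hφ : IsTest Ω φ) {x : E n} (hx : x ∉ Ω) : φ x = 0 :=
  image_eq_zero_of_notMem_tsupport fun h => hx (hφ.support_subset h)

theorem continuous_partialDeriv {φ : E n → ℂ} (hφ : IsTest Ω φ) (i : Fin n) :
    Continuous (partialDeriv i φ) :=
  (hφ.smooth.continuous_fderiv (by simp)).clm_apply continuous_const

theorem l2n_translate (h : E n → ℝ≥0∞) (P : E n) :
    l2n volume (fun w => h (P + w)) = l2n volume h := by
  unfold l2n
  rw [lintegral_add_left_eq_self (fun w => h w ^ (2 : ℝ)) P]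

theorem l2n_restrict_eq {h : E n → ℝ≥0∞} (h0 : ∀ x ∉ Ω, h x = 0) :
    l2n (volume.restrict Ω) h = l2n volume h := by
  unfold l2n
  rw [setLIntegral_eq_of_support_subset fun x hx => ?_]
  by_contra hc
  simp [h0 x hc] at hx

/-- The extension by zero of a function in `H₀¹(Ω)`, centred at `P`, with its weighted bounds. -/
theorem exists_zeroExtension (hΩ : IsOpen Ω) (hP : P ∉ Ω) (hR0 : 0 ≤ R)
    (hR : ∀ w, P + w ∈ Ω → ‖w‖ ≤ R) (h0 : 0 < α) (h1 : α < 1) {f : E n → ℂ} (hf : MemH01 Ω f) :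
    ∃ u : E n → ℂ, Measurable u ∧ (∀ w, P + w ∉ Ω → u w = 0) ∧
      (∀ᵐ w, P + w ∈ Ω → u w = f (P + w)) ∧ l2n volume (fun w => ‖u w‖ₑ) ≠ ⊤ ∧ wn α u ≠ ⊤ ∧
      ∃ C : ℝ≥0, ∀ τ : ℝ, 1 ≤ τ → wn α (fun w => u w - u (τ • w)) ≤ C * ENNReal.ofReal (τ - 1) := by
  obtain ⟨hfL, Df, hD, φ, hφ, hφf, hφD⟩ := hf
  have hmP : MeasurePreserving (fun w : E n => P + w) volume volume := measurePreserving_add_left _ P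
  set f' : E n → ℂ := Ω.indicator (hfL.1.mk f) with hf'
  have hf'm : Measurable f' := hfL.1.stronglyMeasurable_mk.measurable.indicator hΩ.measurableSet
  have hf'0 : ∀ x ∉ Ω, f' x = 0 := fun x hx => indicator_of_notMem hx _
  have hff' : ∀ᵐ x, x ∈ Ω → f' x = f x := by
    have := hfL.1.ae_eq_mk
    rw [Filter.EventuallyEq, ae_restrict_iff' hΩ.measurableSet] at this
    filter_upwards [this] with x hx hxΩ
    rw [hf', indicator_of_mem hxΩ, hx hxΩ]
  -- L₂-convergence gives almost everywhere convergence along a subsequence, as Fatou's lemma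
  -- requires.
  obtain ⟨ns, hns, hlim⟩ := (tendstoInMeasure_of_tendsto_eLpNorm (by norm_num)
    (fun k => (hφ k).smooth.continuous.aestronglyMeasurable) hfL.1 hφf).exists_seq_tendsto_ae
  have hlim' : ∀ᵐ x, Tendsto (fun k => φ (ns k) x) atTop (𝓝 (f' x)) := by
    rw [ae_restrict_iff' hΩ.measurableSet] at hlim
    filter_upwards [hlim, hff'] with x hx hx'
    by_cases hxΩ : x ∈ Ω
    · rw [hx' hxΩ]; exact hx hxΩ
    · rw [hf'0 x hxΩ]
      simp [fun k => (hφ (ns k)).eq_zero hxΩ]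
  set u : E n → ℂ := fun w => f' (P + w) with hu
  have hum : Measurable u := hf'm.comp (by fun_prop)
  set ψ : ℕ → E n → ℂ := fun k w => φ (ns k) (P + w) with hψ
  have hψc : ∀ k, ContDiff ℝ 1 (ψ k) := fun k =>
    ((hφ (ns k)).smooth.of_le (by simp)).comp (contDiff_const.add contDiff_id)
  have hψs : ∀ k, HasCompactSupport (ψ k) := fun k =>
    (hφ (ns k)).compact_support.comp_homeomorph (Homeomorph.addLeft P)
  have hψ0 : ∀ k, (0 : E n) ∉ tsupport (ψ k) := by
    intro k h
    have h2 : tsupport (ψ k) ⊆ (fun w => P + w) ⁻¹' tsupport (φ (ns k)) :=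
      tsupport_comp_subset_preimage (φ (ns k)) (f := fun w => P + w) (by fun_prop)
    have := (hφ (ns k)).support_subset (h2 h)
    simp at this
    exact hP this
  have hψR : ∀ k w, ψ k w ≠ 0 → ‖w‖ ≤ R := by
    intro k w hw
    refine hR w ?_
    by_contra h
    exact hw ((hφ (ns k)).eq_zero h)
  set S : ℕ → E n → ℝ≥0∞ := fun k w => ∑ i, ‖partialDeriv i (φ (ns k)) (P + w)‖ₑ with hS
  have hpm : ∀ k i, Measurable fun x => ‖partialDeriv i (φ (ns k)) x‖ₑ := fun k i =>
    (continuous_partialDeriv (hφ (ns k)) i).measurable.enorm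
  have hSm : ∀ k, Measurable (S k) := fun k =>
    Finset.measurable_fun_sum _ fun i _ => (hpm k i).comp (by fun_prop)
  have hSψ : ∀ k w v, ‖fderiv ℝ (ψ k) w v‖ₑ ≤ S k w * ‖v‖ₑ := by
    intro k w v
    rw [hψ]
    simp only
    rw [fderiv_comp_add_left]
    exact enorm_fderiv_le_sum _ _ _
  -- C₀ bounds the gradients of the approximants as soon as each partial derivative is within 1 of
  -- its limit in L₂.
  set C₀ : ℝ≥0∞ := ∑ i, (1 + eLpNorm (Df i) 2 (volume.restrict Ω)) with hC₀
  have hC₀t : C₀ ≠ ⊤ := by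
    rw [hC₀, ENNReal.sum_ne_top]
    exact fun i _ => ENNReal.add_ne_top.2 ⟨ENNReal.one_ne_top, (hD i).1.2.ne⟩
  have hSb : ∀ᶠ k in atTop, l2n volume (S k) ≤ C₀ := by
    have : ∀ i, ∀ᶠ k in atTop,
        eLpNorm (partialDeriv i (φ (ns k)) - Df i) 2 (volume.restrict Ω) ≤ 1 := fun i =>
      ((hφD i).comp hns.tendsto_atTop).eventually (ge_mem_nhds one_pos)
    filter_upwards [eventually_all.2 this] with k hk
    refine (l2n_sum_le (h := fun i w => ‖partialDeriv i (φ (ns k)) (P + w)‖ₑ) _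
      fun i => (hpm k i).comp (by fun_prop)).trans (Finset.sum_le_sum fun i _ => ?_)
    rw [l2n_translate (fun x => ‖partialDeriv i (φ (ns k)) x‖ₑ), ← l2n_restrict_eq
      (fun x hx => by simp [partialDeriv_eq_zero (hφ (ns k)) i hx]), l2n_eq_eLpNorm]
    have hpc := (continuous_partialDeriv (hφ (ns k)) i).aestronglyMeasurable (μ := volume.restrict Ω)
    calc _ = eLpNorm (partialDeriv i (φ (ns k)) - Df i + Df i) 2 (volume.restrict Ω) := by
          rw [sub_add_cancel]
      _ ≤ _ := (eLpNorm_add_le (hpc.sub (hD i).1.1) (hD i).1.1 (by norm_num)).trans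
          (add_le_add (hk i) le_rfl)
  have hψm : ∀ k, Measurable (ψ k) := fun k => (hψc k).continuous.measurable
  have hψu : ∀ᵐ w, Tendsto (fun k => ψ k w) atTop (𝓝 (u w)) := hmP.quasiMeasurePreserving.ae hlim'
  have htend : ∀ (v : ℕ → E n → ℂ) (v' : E n → ℂ) (w : E n), Tendsto (fun k => v k w) atTop (𝓝 (v' w)) →
      Tendsto (fun k => wt α (v k) w) atTop (𝓝 (wt α v' w)) := fun v v' w h =>
    ENNReal.Tendsto.const_mul h.enorm (Or.inr ENNReal.ofReal_ne_top)
  obtain ⟨C, hC⟩ := exists_wn_le n h0 h1 R hR0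
  refine ⟨u, hum, fun w hw => hf'0 _ hw, hmP.quasiMeasurePreserving.ae hff', ?_, ?_, ?_⟩
  · rw [l2n_translate (fun x => ‖f' x‖ₑ) P, ← l2n_restrict_eq (fun x hx => by simp [hf'0 x hx]),
      l2n_eq_eLpNorm]
    rw [eLpNorm_congr_ae ((ae_restrict_iff' hΩ.measurableSet).2 hff')]
    exact hfL.2.ne
  · refine ne_top_of_le_ne_top (ENNReal.mul_ne_top ENNReal.coe_ne_top hC₀t) (b := C * C₀) ?_
    refine l2n_le_of_tendsto (h := fun k => wt α (ψ k)) (fun k => measurable_wt (hψm k)) ?_ ?_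
    · filter_upwards [hψu] with w hw using htend ψ u w hw
    · filter_upwards [hSb] with k hk
      refine (hC (ψ k) (S k) (hψc k) (hψs k) (hψ0 k) (hSm k) (hSψ k) (hψR k)).trans ?_
      gcongr
  · refine ⟨(R ^ (1 - α)).toNNReal * C₀.toNNReal, fun τ hτ => ?_⟩
    rw [ENNReal.coe_mul, ENNReal.coe_toNNReal hC₀t]
    have hτ0 : τ ≠ 0 := by positivity
    refine l2n_le_of_tendsto (h := fun k => wt α (fun w => ψ k w - ψ k (τ • w)))
      (fun k => measurable_wt ((hψm k).sub ((hψm k).comp (by fun_prop)))) ?_ ?_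
    · filter_upwards [hψu, (Measure.quasiMeasurePreserving_smul volume hτ0).ae hψu] with w hw hw'
      exact htend (fun k w => ψ k w - ψ k (τ • w)) _ w (hw.sub hw')
    · filter_upwards [hSb] with k hk
      refine (wn_sub_smul_le (hψc k) (hSm k) (hSψ k) (hψR k) hR0 h1 hτ).trans ?_
      calc _ ≤ ENNReal.ofReal (R ^ (1 - α)) * (ENNReal.ofReal (τ - 1) * C₀) := by gcongr
        _ = _ := by rw [ENNReal.ofReal]; ring

theorem measurable_indicator_of_continuousOn (hΩ : IsOpen Ω) {ρ : E n → ℂ} (hρ : ContinuousOn ρ Ω) :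
    Measurable (Ω.indicator ρ) := by
  classical
  rw [← piecewise_eq_indicator]
  exact hρ.measurable_piecewise continuousOn_const hΩ.measurableSet

/-- The product of a Hölder function and a function in `H₀¹(Ω)`, extended by zero. -/
theorem exists_zeroExtension_mul (hΩ : IsOpen Ω) (hconv : Convex ℝ Ω) (hP : P ∈ frontier Ω)
    (hR0 : 0 ≤ R) (hR : ∀ w, P + w ∈ Ω → ‖w‖ ≤ R) (h0 : 0 < α) (h1 : α < 1) {lam : ℝ≥0}
    (hlam : α < lam) (hlam1 : lam ≤ 1) {ρ f : E n → ℂ} (hρ : IsLip lam Ω ρ) (hf : MemH01 Ω f) :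
    ∃ U : E n → ℂ, Measurable U ∧ (∀ w, P + w ∉ Ω → U w = 0) ∧
      (∀ᵐ w, P + w ∈ Ω → U w = ρ (P + w) * f (P + w)) ∧ wn α U ≠ ⊤ ∧
      ∃ K : ℝ≥0, ∀ τ : ℝ, 1 ≤ τ → τ ≤ 2 →
        wn α (fun w => U w - U (τ • w)) ≤ K * ENNReal.ofReal ((τ - 1) ^ (lam : ℝ)) := by
  have hPΩ : P ∉ Ω := by
    rw [hΩ.frontier_eq] at hP; exact hP.2
  have hPc : P ∈ closure Ω := frontier_subset_closure hP
  have hlam0 : (0 : ℝ) < lam := h0.trans hlam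
  obtain ⟨M, hM⟩ := hρ
  obtain ⟨u, hum, hu0, huf, hu2, hA, C, hB⟩ := exists_zeroExtension hΩ hPΩ hR0 hR h0 h1 hf
  have hdist : ∀ w w', P + w ∈ closure Ω → P + w' ∈ closure Ω →
      ‖ρ (P + w) - ρ (P + w')‖ ≤ M * ‖w - w'‖ ^ (lam : ℝ) := by
    intro w w' hw hw'
    have := hM.dist_le hw hw'
    simpa [dist_eq_norm] using this
  set r : E n → ℂ := fun w => Ω.indicator ρ (P + w) with hr
  have hrm : Measurable r := (measurable_indicator_of_continuousOn hΩ
    ((hM.continuousOn (by exact_mod_cast hlam0)).mono subset_closure)).comp (by fun_prop)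
  -- The Hölder condition measured from P, which lies in the closure, bounds ρ on Ω.
  set B : ℝ := ‖ρ P‖ + M * R ^ (lam : ℝ) with hBdef
  have hB0 : 0 ≤ B := by positivity
  have hrB : ∀ w, ‖r w‖ ≤ B := by
    intro w
    by_cases hw : P + w ∈ Ω
    · rw [hr]; simp only; rw [indicator_of_mem hw]
      have h2 := hdist w 0 (subset_closure hw) (by simpa using hPc)
      have h3 : M * ‖w‖ ^ (lam : ℝ) ≤ M * R ^ (lam : ℝ) := by
        gcongr; exact hR w hw
      have h4 := norm_le_norm_add_norm_sub' (ρ (P + w)) (ρ P)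
      simp only [add_zero, sub_zero] at h2
      linarith
    · rw [hr]; simp only; rw [indicator_of_notMem hw]; simpa using hB0
  have hrBe : ∀ w, ‖r w‖ₑ ≤ ENNReal.ofReal B := fun w => by
    rw [← ofReal_norm]; exact ENNReal.ofReal_le_ofReal (hrB w)
  set U : E n → ℂ := fun w => r w * u w with hU
  refine ⟨U, hrm.mul hum, fun w hw => by simp [hU, hu0 w hw], ?_, ?_, ?_⟩
  · filter_upwards [huf] with w hw hwΩ
    rw [hU, hr]; simp only
    rw [indicator_of_mem hwΩ, hw hwΩ]
  · have : wn α U ≤ ENNReal.ofReal B * wn α u := by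
      rw [wn, wn, ← l2n_const_mul (measurable_wt hum)]
      refine l2n_mono fun w => ?_
      unfold wt
      rw [hU]; simp only
      rw [enorm_mul, mul_left_comm]
      gcongr
      exact hrBe w
    exact ne_top_of_le_ne_top (ENNReal.mul_ne_top ENNReal.ofReal_ne_top hA) this
  set N : ℝ≥0∞ := l2n volume (fun w => ‖u w‖ₑ) with hN
  refine ⟨B.toNNReal * C + (M * R ^ (lam - α)).toNNReal * N.toNNReal, fun τ hτ1 hτ2 => ?_⟩
  have hτ0 : 0 < τ := by linarith
  set T : ℝ := (τ - 1) ^ (lam : ℝ) with hT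
  have hT0 : 0 ≤ T := Real.rpow_nonneg (by linarith) _
  have huτ : Measurable fun w : E n => u (τ • w) := hum.comp (by fun_prop)
  -- Product rule for differences: r(w)(u(w) - u(τw)) + (r(w) - r(τw)) u(τw).
  have hpt : ∀ w, wt α (fun w => U w - U (τ • w)) w ≤
      ENNReal.ofReal B * wt α (fun w => u w - u (τ • w)) w +
        ENNReal.ofReal (M * R ^ (lam - α) * T) * ‖u (τ • w)‖ₑ := by
    intro w
    by_cases hτw : P + τ • w ∈ Ω
    -- Convexity brings P + w into Ω together with P + τw, so the Hölder bound applies to this pair.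
    · have hw : P + w ∈ Ω := by
        have := hconv.add_smul_mem_interior' hPc (y := τ • w) (by rwa [hΩ.interior_eq])
          (t := τ⁻¹) ⟨by positivity, inv_le_one_of_one_le₀ hτ1⟩
        rwa [smul_smul, inv_mul_cancel₀ hτ0.ne', one_smul, hΩ.interior_eq] at this
      have hw0 : 0 < ‖w‖ := by
        rw [norm_pos_iff]; rintro rfl
        simp at hw; exact hPΩ hw
      have e : U w - U (τ • w) = r w * (u w - u (τ • w)) + (r w - r (τ • w)) * u (τ • w) := by
        simp only [hU]; ring
      unfold wt
      simp only
      rw [e]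
      -- Since λ > α, the weight leaves the nonnegative power |w|^(λ-α), bounded by R^(λ-α).
      have hrr : ‖w‖ ^ (-α) * ‖r w - r (τ • w)‖ ≤ M * R ^ (lam - α) * T := by
        have h2 : ‖r w - r (τ • w)‖ ≤ M * ((τ - 1) * ‖w‖) ^ (lam : ℝ) := by
          simp only [hr]
          rw [indicator_of_mem hw, indicator_of_mem hτw]
          refine (hdist _ _ (subset_closure hw) (subset_closure hτw)).trans (le_of_eq ?_)
          have : w - τ • w = (1 - τ) • w := by rw [sub_smul, one_smul]
          rw [this, norm_smul, Real.norm_eq_abs, abs_sub_comm, abs_of_nonneg (by linarith)]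
        calc _ ≤ ‖w‖ ^ (-α) * (M * ((τ - 1) * ‖w‖) ^ (lam : ℝ)) := by gcongr
          _ = M * ‖w‖ ^ (lam - α) * T := by
              rw [Real.mul_rpow (by linarith) hw0.le, Real.rpow_sub hw0, Real.rpow_neg hw0.le]
              rw [hT]; field_simp
          _ ≤ _ := by
              gcongr _ * ?_ * T
              exact Real.rpow_le_rpow hw0.le (hR w hw) (by linarith)
      calc _ ≤ ENNReal.ofReal (‖w‖ ^ (-α)) *
              (‖r w‖ₑ * ‖u w - u (τ • w)‖ₑ + ‖r w - r (τ • w)‖ₑ * ‖u (τ • w)‖ₑ) := by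
            gcongr
            refine (enorm_add_le _ _).trans ?_
            rw [enorm_mul, enorm_mul]
        _ = ‖r w‖ₑ * (ENNReal.ofReal (‖w‖ ^ (-α)) * ‖u w - u (τ • w)‖ₑ) +
              ENNReal.ofReal (‖w‖ ^ (-α) * ‖r w - r (τ • w)‖) * ‖u (τ • w)‖ₑ := by
            rw [ENNReal.ofReal_mul (by positivity), ofReal_norm]; ring
        _ ≤ _ := by
            gcongr
            exact hrBe w
    -- Here r may jump between w and τw, but the term containing that jump is multiplied by u(τw) =
    -- 0.
    · have e1 : u (τ • w) = 0 := hu0 _ hτw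
      unfold wt
      simp only [hU, e1, mul_zero, sub_zero, enorm_zero, add_zero, enorm_mul]
      rw [mul_left_comm]
      gcongr
      exact hrBe w
  have hm1 : Measurable (wt α fun w => u w - u (τ • w)) := measurable_wt (hum.sub huτ)
  have hNt : l2n volume (fun w => ‖u (τ • w)‖ₑ) ≤ N := by
    rw [l2n_comp_smul (h := fun w => ‖u w‖ₑ) hum.enorm hτ0]
    refine mul_le_of_le_one_left zero_le ?_
    rw [ENNReal.ofReal_le_one]
    refine Real.rpow_le_one_of_one_le_of_nonpos hτ1 ?_
    have : (0 : ℝ) ≤ n := n.cast_nonneg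
    linarith
  calc _ ≤ l2n volume fun w => ENNReal.ofReal B * wt α (fun w => u w - u (τ • w)) w +
        ENNReal.ofReal (M * R ^ (lam - α) * T) * ‖u (τ • w)‖ₑ := l2n_mono hpt
    _ ≤ ENNReal.ofReal B * wn α (fun w => u w - u (τ • w)) +
        ENNReal.ofReal (M * R ^ (lam - α) * T) * l2n volume (fun w => ‖u (τ • w)‖ₑ) := by
        rw [wn, ← l2n_const_mul hm1, ← l2n_const_mul huτ.enorm]
        exact l2n_add_le (hm1.const_mul _).aemeasurable (huτ.enorm.const_mul _).aemeasurable
    _ ≤ ENNReal.ofReal B * (C * ENNReal.ofReal T) + ENNReal.ofReal (M * R ^ (lam - α) * T) * N := by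
        gcongr
        refine (hB τ hτ1).trans ?_
        gcongr
        exact Real.self_le_rpow_of_le_one (by linarith) (by linarith) (by exact_mod_cast hlam1)
    _ = _ := by
        rw [ENNReal.ofReal_mul (by positivity)]
        push_cast
        rw [ENNReal.coe_toNNReal hu2]
        simp only [ENNReal.ofReal]
        ring

end Sobolev

/-! ### Inversion along rays -/

section Rays

variable {n : ℕ}

/-- The function `U` along the ray in the direction `w`, with weight `|t| ^ k`; the ray is
parametrised by `t > 0` if `e = 1` and by `t < 0` if `e = -1`. -/
noncomputable def rad (k : ℕ) (e : ℝ) (U : E n → ℂ) (t : ℝ) (w : E n) : ℂ :=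
  if 0 < e * t then ((e * t) ^ k) • U ((e * t) • w) else 0

/-- The Marchaud derivative along rays. -/
noncomputable def radDeriv (α : ℝ) (k : ℕ) (e : ℝ) (U : E n → ℂ) (w : E n) : ℂ :=
  ∫ σ in Ioi (0 : ℝ), (σ ^ (-1 - α) * ‖w‖ ^ (-α)) • (U w - rad k e U (e - σ) w)

/-- A majorant of the Marchaud derivative along rays. -/
noncomputable def radMaj (α : ℝ) (k : ℕ) (e : ℝ) (U : E n → ℂ) (w : E n) : ℝ≥0∞ :=
  ∫⁻ σ in Ioi (0 : ℝ), ENNReal.ofReal (σ ^ (-1 - α)) * wt α (fun w => U w - rad k e U (e - σ) w) w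

/-- The fractional integral of `g` along the ray through `w` converges, and equals `c |w|^{-α} U(w)`. -/
def RadInverts (α : ℝ) (k : ℕ) (e c : ℝ) (g U : E n → ℂ) (w : E n) : Prop :=
  IntegrableOn (fun σ : ℝ => σ ^ (α - 1) • rad k e g (e - σ) w) (Ioi 0) ∧
    ‖w‖ ^ α • ∫ σ in Ioi (0 : ℝ), σ ^ (α - 1) • rad k e g (e - σ) w = c • U w

variable {k : ℕ} {e α : ℝ} {U g : E n → ℂ}

theorem measurable_rad (hU : Measurable U) : Measurable fun p : ℝ × E n => rad k e U p.1 p.2 := by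
  unfold rad
  refine Measurable.ite (measurableSet_lt measurable_const (by fun_prop)) ?_ measurable_const
  exact Measurable.fun_smul (by fun_prop) (hU.comp (by fun_prop))

theorem rad_mul {r : ℝ} (hr : 0 < r) (t : ℝ) (v : E n) :
    rad k e U (r * t) v = r ^ k • rad k e U t (r • v) := by
  unfold rad
  rw [show e * (r * t) = r * (e * t) by ring]
  by_cases h : 0 < e * t
  · rw [if_pos h, if_pos (mul_pos hr h), smul_smul, smul_smul, mul_pow, mul_comm r]
  · rw [if_neg h, if_neg (fun h' => h ((pos_iff_pos_of_mul_pos h').1 hr)), smul_zero]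

theorem measurable_wt_rad (hU : Measurable U) :
    Measurable (Function.uncurry fun (w : E n) (σ : ℝ) => ENNReal.ofReal (σ ^ (-1 - α)) *
      wt α (fun w => U w - rad k e U (e - σ) w) w) := by
  unfold wt Function.uncurry
  have h1 : Measurable fun p : E n × ℝ => rad k e U (e - p.2) p.1 :=
    (measurable_rad hU).comp (by fun_prop : Measurable fun p : E n × ℝ => (e - p.2, p.1))
  have h2 : Measurable fun p : E n × ℝ => U p.1 := hU.comp measurable_fst
  have h3 := (h2.sub h1).enorm
  refine Measurable.mul (by fun_prop) (Measurable.mul (by fun_prop) h3)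

theorem measurable_radMaj (hU : Measurable U) : Measurable (radMaj α k e U) :=
  (measurable_wt_rad hU).lintegral_prod_right

theorem stronglyMeasurable_radDeriv (hU : Measurable U) : StronglyMeasurable (radDeriv α k e U) := by
  unfold radDeriv
  have h1 : Measurable fun p : E n × ℝ => rad k e U (e - p.2) p.1 :=
    (measurable_rad hU).comp (by fun_prop : Measurable fun p : E n × ℝ => (e - p.2, p.1))
  have h2 : Measurable fun p : E n × ℝ => U p.1 := hU.comp measurable_fst
  have : Measurable fun p : E n × ℝ =>
      (p.2 ^ (-1 - α) * ‖p.1‖ ^ (-α)) • (U p.1 - rad k e U (e - p.2) p.1) :=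
    Measurable.fun_smul (by fun_prop) (h2.sub h1)
  exact this.stronglyMeasurable.integral_prod_right'

theorem enorm_radDeriv_le (w : E n) : ‖radDeriv α k e U w‖ₑ ≤ radMaj α k e U w := by
  refine (enorm_integral_le_lintegral_enorm _).trans (setLIntegral_mono' measurableSet_Ioi fun σ hσ => ?_)
  have hσ : 0 < σ := hσ
  unfold wt
  rw [enorm_smul, Real.enorm_of_nonneg (by positivity), ENNReal.ofReal_mul (by positivity), mul_assoc]

theorem lintegral_Ioi_comp_mul_left {h : ℝ → ℝ≥0∞} {q : ℝ} (hq : 0 < q) :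
    ∫⁻ s in Ioi 0, h s = ENNReal.ofReal q * ∫⁻ σ in Ioi 0, h (q * σ) := by
  have himg : (fun σ : ℝ => q * σ) '' Ioi 0 = Ioi 0 := by
    rw [image_mul_left_Ioi hq]; simp
  rw [← lintegral_const_mul' _ _ ENNReal.ofReal_ne_top]
  conv_lhs => rw [← himg]
  rw [lintegral_image_eq_lintegral_abs_deriv_mul measurableSet_Ioi (f' := fun _ => q)
    (fun x _ => by simpa using ((hasDerivAt_id x).const_mul q).hasDerivWithinAt)
    (fun x _ y _ hxy => by simpa [hq.ne'] using hxy), abs_of_pos hq]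

/-- Collects the powers of q produced by s = qσ: the Jacobian, the kernel and the weight on one
side, the normalisation by |w|^(-α) in `radDeriv` on the other. -/
theorem ray_identity {q : ℝ} (hq : 0 < q) {v : E n} (hv : v ≠ 0) :
    q * (q ^ (-1 - α) * q ^ k) = q ^ k * ‖v‖ ^ α * ‖q • v‖ ^ (-α) := by
  have hv0 : 0 < ‖v‖ := norm_pos_iff.2 hv
  have h1 : ‖v‖ ^ α ≠ 0 := (Real.rpow_pos_of_pos hv0 _).ne'
  rw [norm_smul, Real.norm_of_nonneg hq.le, Real.mul_rpow hq.le hv0.le,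
    Real.rpow_neg hv0.le, show -1 - α = -α - 1 by ring, Real.rpow_sub_one hq.ne']
  field_simp

theorem marchaud_rad (he : e * e = 1) {t : ℝ} (ht : 0 < e * t) {v : E n} (hv : v ≠ 0) :
    marchaud α (fun t => rad k e U t v) t = ‖v‖ ^ α • rad k e (radDeriv α k e U) t v := by
  have hv0 : 0 < ‖v‖ := norm_pos_iff.2 hv
  set q := e * t with hq
  have htq : t = q * e := by rw [hq]; linear_combination (-t) * he
  have hsub := integral_comp_mul_left_Ioi'
    (fun s : ℝ => s ^ (-1 - α) • (rad k e U t v - rad k e U (t - s) v)) 0 ht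
  rw [mul_zero] at hsub
  unfold marchaud
  rw [← hsub]
  rw [show rad k e (radDeriv α k e U) t v = q ^ k • radDeriv α k e U (q • v) by
    rw [rad, if_pos ht]]
  unfold radDeriv
  rw [← integral_smul, ← integral_smul, ← integral_smul]
  refine setIntegral_congr_fun measurableSet_Ioi fun σ hσ => ?_
  have hσ : 0 < σ := hσ
  rw [show t - q * σ = q * (e - σ) by rw [mul_sub, ← htq], rad_mul ht,
    show rad k e U t v = q ^ k • U (q • v) by rw [rad, if_pos ht], ← smul_sub, smul_smul, smul_smul,
    smul_smul, smul_smul]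
  congr 1
  have := ray_identity (k := k) (α := α) ht hv
  rw [Real.mul_rpow ht.le hσ.le]
  linear_combination σ ^ (-1 - α) * this

theorem lintegral_marchaud_rad (he : e * e = 1) {t : ℝ} (ht : 0 < e * t) {v : E n} (hv : v ≠ 0) :
    ∫⁻ s in Ioi (0 : ℝ), ‖s ^ (-1 - α) • (rad k e U t v - rad k e U (t - s) v)‖ₑ =
      ENNReal.ofReal (‖v‖ ^ α) * (ENNReal.ofReal ((e * t) ^ k) * radMaj α k e U ((e * t) • v)) := by
  have hv0 : 0 < ‖v‖ := norm_pos_iff.2 hv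
  set q := e * t with hq
  have htq : t = q * e := by rw [hq]; linear_combination (-t) * he
  rw [lintegral_Ioi_comp_mul_left ht]
  unfold radMaj
  rw [← lintegral_const_mul' _ _ ENNReal.ofReal_ne_top, ← lintegral_const_mul' _ _ ENNReal.ofReal_ne_top,
    ← lintegral_const_mul' _ _ ENNReal.ofReal_ne_top]
  refine setLIntegral_congr_fun measurableSet_Ioi fun σ hσ => ?_
  have hσ : 0 < σ := hσ
  unfold wt
  simp only
  rw [show t - q * σ = q * (e - σ) by rw [mul_sub, ← htq], rad_mul ht,
    show rad k e U t v = q ^ k • U (q • v) by rw [rad, if_pos ht], ← smul_sub, smul_smul,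
    enorm_smul, Real.enorm_of_nonneg (by positivity), ← mul_assoc, ← mul_assoc, ← mul_assoc,
    ← mul_assoc, ← ENNReal.ofReal_mul (by positivity), ← ENNReal.ofReal_mul (by positivity),
    ← ENNReal.ofReal_mul (by positivity), ← ENNReal.ofReal_mul (by positivity)]
  congr 2
  have := ray_identity (k := k) (α := α) ht hv
  rw [Real.mul_rpow ht.le hσ.le]
  linear_combination σ ^ (-1 - α) * this

/-- `RadInverts` is normalised to be invariant under dilation, with the point itself at parameter e.
Rescaling s = (e r)σ moves the parameter r on the ray of v to that position. -/
theorem radInverts_of_conv {c : ℝ} (he : e * e = 1) {r : ℝ} (hr : 0 < e * r) {v : E n} (hv : v ≠ 0)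
    (hi : IntegrableOn (fun s : ℝ => s ^ (α - 1) • ‖v‖ ^ α • rad k e g (r - s) v) (Ioi 0))
    (heq : ∫ s in Ioi (0 : ℝ), s ^ (α - 1) • ‖v‖ ^ α • rad k e g (r - s) v = c • rad k e U r v) :
    RadInverts α k e c g U ((e * r) • v) := by
  have hv0 : 0 < ‖v‖ := norm_pos_iff.2 hv
  set q := e * r with hq
  have hrq : r = q * e := by rw [hq]; linear_combination (-r) * he
  have hqk : q ^ k ≠ 0 := (pow_pos hr k).ne'
  set d : ℝ := q ^ (α - 1) * ‖v‖ ^ α * q ^ k with hd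
  have hd0 : d ≠ 0 := by positivity
  have key : ∀ σ ∈ Ioi (0 : ℝ), (q * σ) ^ (α - 1) • ‖v‖ ^ α • rad k e g (r - q * σ) v =
      d • (σ ^ (α - 1) • rad k e g (e - σ) (q • v)) := by
    intro σ hσ
    have hσ : 0 < σ := hσ
    rw [show r - q * σ = q * (e - σ) by rw [mul_sub, ← hrq], rad_mul hr, smul_smul, smul_smul, smul_smul]
    congr 1
    rw [Real.mul_rpow hr.le hσ.le]; ring
  have hsub := integral_comp_mul_left_Ioi'
    (fun s : ℝ => s ^ (α - 1) • ‖v‖ ^ α • rad k e g (r - s) v) 0 hr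
  rw [mul_zero, heq, setIntegral_congr_fun measurableSet_Ioi key, integral_smul,
    show rad k e U r v = q ^ k • U (q • v) by rw [rad, if_pos hr]] at hsub
  rw [← mul_zero q, ← integrableOn_Ioi_comp_mul_left_iff _ _ hr] at hi
  have hi' := (integrableOn_congr_fun key measurableSet_Ioi).1 hi
  constructor
  · have := Integrable.smul d⁻¹ hi'
    refine this.congr (Eventually.of_forall fun σ => ?_)
    simp only [Pi.smul_apply, smul_smul, inv_mul_cancel₀ hd0, one_mul, ← mul_assoc]
  · have h2 : q ^ k • (‖q • v‖ ^ α • ∫ σ in Ioi (0 : ℝ), σ ^ (α - 1) • rad k e g (e - σ) (q • v)) =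
        q ^ k • (c • U (q • v)) := by
      rw [smul_comm _ c, ← hsub, smul_smul, smul_smul]
      congr 1
      rw [hd, norm_smul, Real.norm_of_nonneg hr.le, Real.mul_rpow hr.le hv0.le,
        Real.rpow_sub_one hr.ne']
      field_simp
    exact smul_right_injective ℂ hqk h2

theorem ae_radInverts_ray (h0 : 0 < α) (h1 : α < 1) (hU : Measurable U) {a X : ℝ}
    (he : e = 1 ∨ e = -1 ∧ X ≤ 0) {v : E n} (hv : v ≠ 0) (ha : ∀ r ≤ a, rad k e U r v = 0)
    (hfin : ∫⁻ r in Iio X ∩ {r | 0 < e * r},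
      ENNReal.ofReal ((e * r) ^ k) * radMaj α k e U ((e * r) • v) ≠ ⊤) :
    ∀ᵐ r ∂(volume.restrict (Iio X)), 0 < e * r →
      RadInverts α k e (α⁻¹ * betaConst α) (radDeriv α k e U) U ((e * r) • v) := by
  have hee : e * e = 1 := by rcases he with rfl | ⟨rfl, _⟩ <;> norm_num
  -- A parameter r < X off the ray has nothing of the ray to its left. For e = -1 the condition X ≤
  -- 0 puts every r < X on the ray, so the jump at 0 is never seen.
  have hout : ∀ r < X, ¬ 0 < e * r → ∀ t ≤ r, ¬ 0 < e * t := by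
    intro r hrX hr t htr
    rcases he with rfl | ⟨rfl, hX⟩
    · linarith
    · exact absurd (by linarith) hr
  set F : ℝ → ℂ := fun t => rad k e U t v with hF
  have hFm : Measurable F := (measurable_rad hU).comp (measurable_id.prodMk measurable_const)
  have hzero : ∀ r < X, ¬ 0 < e * r → ∀ s, 0 ≤ s → F (r - s) = 0 := by
    intro r hrX hr s hs
    simp only [hF, rad, if_neg (hout r hrX hr (r - s) (by linarith))]
  have hset : MeasurableSet {r : ℝ | 0 < e * r} := measurableSet_lt measurable_const (by fun_prop)
  have hm : Measurable fun p : ℝ × ℝ => p.2 ^ (-1 - α) • (F p.1 - F (p.1 - p.2)) :=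
    Measurable.fun_smul (by fun_prop) ((hFm.comp measurable_fst).sub (hFm.comp (by fun_prop)))
  have hint : Integrable (fun p : ℝ × ℝ => p.2 ^ (-1 - α) • (F p.1 - F (p.1 - p.2)))
      ((volume.restrict (Iio X)).prod (volume.restrict (Ioi 0))) := by
    refine ⟨hm.aestronglyMeasurable, ?_⟩
    rw [hasFiniteIntegral_iff_enorm, lintegral_prod _ hm.enorm.aemeasurable]
    have hinner : ∀ r ∈ Iio X, ∫⁻ s in Ioi (0 : ℝ), ‖s ^ (-1 - α) • (F r - F (r - s))‖ₑ =
        {r | 0 < e * r}.indicator (fun r => ENNReal.ofReal (‖v‖ ^ α) *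
          (ENNReal.ofReal ((e * r) ^ k) * radMaj α k e U ((e * r) • v))) r := by
      intro r hrX
      by_cases hr : 0 < e * r
      · rw [indicator_of_mem (by exact hr)]
        exact lintegral_marchaud_rad hee hr hv
      · rw [indicator_of_notMem (by exact hr), setLIntegral_congr_fun (g := fun _ => 0) measurableSet_Ioi]
        · simp
        · intro s hs
          have hs : 0 < s := hs
          have := hzero r hrX hr 0 le_rfl
          rw [sub_zero] at this
          simp [this, hzero r hrX hr s hs.le]
    rw [setLIntegral_congr_fun measurableSet_Iio hinner, setLIntegral_indicator hset, inter_comm,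
      lintegral_const_mul' _ _ ENNReal.ofReal_ne_top]
    exact ENNReal.mul_lt_top ENNReal.ofReal_lt_top (lt_top_iff_ne_top.2 hfin)
  have hmar : ∀ t < X, marchaud α F t = ‖v‖ ^ α • rad k e (radDeriv α k e U) t v := by
    intro t htX
    by_cases ht : 0 < e * t
    · exact marchaud_rad hee ht hv
    · rw [marchaud_eq_zero (a := t) _ le_rfl, rad, if_neg ht, smul_zero]
      intro r hr
      have := hzero t htX ht (t - r) (by linarith)
      simpa using this
  filter_upwards [marchaud_inversion h0 h1 ha hint, ae_restrict_mem measurableSet_Iio] with r hr hrX hre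
  have hrX : r < X := hrX
  have hcongr : ∀ s ∈ Ioi (0 : ℝ), s ^ (α - 1) • marchaud α F (r - s) =
      s ^ (α - 1) • ‖v‖ ^ α • rad k e (radDeriv α k e U) (r - s) v := by
    intro s hs
    have hs : 0 < s := hs
    rw [hmar (r - s) (by linarith)]
  refine radInverts_of_conv hee hre hv ((integrableOn_congr_fun hcongr measurableSet_Ioi).1 hr.1) ?_
  rw [← setIntegral_congr_fun measurableSet_Ioi hcongr]
  exact hr.2

theorem measurableSet_radInverts {c : ℝ} (hg : Measurable g) (hU : Measurable U) :
    MeasurableSet {w | RadInverts α k e c g U w} := by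
  have h1 : Measurable fun p : E n × ℝ => rad k e g (e - p.2) p.1 :=
    (measurable_rad hg).comp (by fun_prop : Measurable fun p : E n × ℝ => (e - p.2, p.1))
  have h2 : StronglyMeasurable fun p : E n × ℝ => p.2 ^ (α - 1) • rad k e g (e - p.2) p.1 :=
    (Measurable.fun_smul (by fun_prop) h1).stronglyMeasurable
  refine MeasurableSet.inter (measurableSet_integrable h2) (measurableSet_eq_fun ?_ (by fun_prop))
  have h3 := h2.integral_prod_right' (ν := volume.restrict (Ioi (0 : ℝ)))
  exact Measurable.fun_smul (by fun_prop) h3.measurable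

/-- Replaces polar coordinates: by Fubini some fixed t > 0 works for almost every v, and v ↦ tv
preserves null sets in both directions. -/
theorem ae_of_ae_ae_smul {p : E n → Prop} (hp : MeasurableSet {w | p w})
    (h : ∀ᵐ v : E n, ∀ᵐ t ∂(volume.restrict (Ioi (0 : ℝ))), p (t • v)) : ∀ᵐ w : E n, p w := by
  have hm : MeasurableSet {q : E n × ℝ | p (q.2 • q.1)} :=
    (by fun_prop : Measurable fun q : E n × ℝ => q.2 • q.1) hp
  rw [Measure.ae_ae_comm (p := fun v t => p (t • v)) hm] at h
  have : NeBot (ae (volume.restrict (Ioi (0 : ℝ)))) := by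
    rw [ae_neBot]; intro h
    rw [Measure.restrict_eq_zero] at h
    simp at h
  obtain ⟨t, ht, hpt⟩ := ((ae_restrict_mem measurableSet_Ioi).and h).exists
  have ht : 0 < t := ht
  have := (Measure.quasiMeasurePreserving_smul (volume : Measure (E n)) (inv_ne_zero ht.ne')).ae hpt
  filter_upwards [this] with w hw
  simpa [smul_smul, ht.ne'] using hw

/-- Dilation by e t multiplies the L₂-norm by (e t)^(-n/2). By Minkowski the ray integral is in L₂
as a function of v, hence finite almost everywhere. -/
theorem ae_lintegral_smul_ne_top {A : E n → ℝ≥0∞} (hA : Measurable A) (hfin : l2n volume A ≠ ⊤)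
    {I : Set ℝ} (hI : MeasurableSet I) (hI0 : ∀ t ∈ I, 0 < e * t)
    (hint : IntegrableOn (fun t => (e * t) ^ k * (e * t) ^ (-(n : ℝ) / 2)) I) :
    ∀ᵐ v : E n, ∫⁻ t in I, ENNReal.ofReal ((e * t) ^ k) * A ((e * t) • v) ≠ ⊤ := by
  have hmeas : Measurable (Function.uncurry fun (v : E n) (t : ℝ) =>
      ENNReal.ofReal ((e * t) ^ k) * A ((e * t) • v)) :=
    Measurable.mul (by fun_prop) (hA.comp (by fun_prop))
  have hb : l2n volume (fun v : E n => ∫⁻ t in I, ENNReal.ofReal ((e * t) ^ k) * A ((e * t) • v)) ≠ ⊤ := by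
    refine ne_top_of_le_ne_top ?_ (l2n_lintegral_le hmeas)
    have : ∫⁻ t in I, l2n volume (fun v : E n => ENNReal.ofReal ((e * t) ^ k) * A ((e * t) • v)) =
        ∫⁻ t in I, ‖(e * t) ^ k * (e * t) ^ (-(n : ℝ) / 2)‖ₑ * l2n volume A := by
      refine setLIntegral_congr_fun hI fun t ht => ?_
      have ht0 := hI0 t ht
      rw [l2n_const_mul (h := fun v => A ((e * t) • v)) (hA.comp (by fun_prop)), l2n_comp_smul hA ht0,
        ← mul_assoc, ← ENNReal.ofReal_mul (by positivity), Real.enorm_of_nonneg (by positivity)]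
    rw [this, lintegral_mul_const' _ _ hfin]
    exact ENNReal.mul_ne_top hint.2.ne hfin
  filter_upwards [ae_lt_top_of_l2n hmeas.lintegral_prod_right hb] with v hv using hv.ne

end Rays

/-! ### Square integrability of the majorants, and inversion at almost every point -/

section Bounds

variable {n : ℕ} {k : ℕ} {e α lam : ℝ} {U : E n → ℂ}

theorem wn_smul (hU : Measurable U) (c : ℝ) :
    wn α (fun w => c • U w) = ‖c‖ₑ * wn α U := by
  rw [wn, wn, ← l2n_const_mul (measurable_wt hU)]
  congr 1; funext w
  unfold wt
  rw [enorm_smul, mul_left_comm]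

theorem l2n_radMaj_ne_top (hU : Measurable U) {κ : ℝ → ℝ} (hκ : IntegrableOn κ (Ioi 0)) {C : ℝ≥0∞}
    (hC : C ≠ ⊤) (h : ∀ σ, 0 < σ → ENNReal.ofReal (σ ^ (-1 - α)) *
      wn α (fun w => U w - rad k e U (e - σ) w) ≤ C * ‖κ σ‖ₑ) :
    l2n volume (radMaj α k e U) ≠ ⊤ := by
  have hle : l2n volume (radMaj α k e U) ≤ ∫⁻ σ in Ioi (0 : ℝ), C * ‖κ σ‖ₑ := by
    refine (l2n_lintegral_le (measurable_wt_rad hU)).trans (setLIntegral_mono' measurableSet_Ioi ?_)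
    intro σ hσ
    have h1 : Measurable fun w : E n => rad k e U (e - σ) w :=
      (measurable_rad hU).comp (by fun_prop : Measurable fun w : E n => (e - σ, w))
    rw [l2n_const_mul (h := wt α (fun w => U w - rad k e U (e - σ) w)) (measurable_wt (hU.sub h1))]
    exact h σ hσ
  refine ne_top_of_le_ne_top ?_ hle
  rw [lintegral_const_mul' _ _ hC]
  exact ENNReal.mul_ne_top hC hκ.2.ne

theorem l2n_radMaj_right_ne_top (hn : 1 ≤ n) (h0 : 0 < α) (h1 : α < 1) (hlam : α < lam)
    (hU : Measurable U) (hA : wn α U ≠ ⊤) {K : ℝ≥0} (hB : ∀ τ : ℝ, 1 ≤ τ → τ ≤ 2 →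
      wn α (fun w => U w - U (τ • w)) ≤ K * ENNReal.ofReal ((τ - 1) ^ lam)) :
    l2n volume (radMaj α 0 (-1) U) ≠ ⊤ := by
  -- The three terms come from the dilation difference for σ < 1 and, for σ ≥ 1, from U(w) and
  -- U((1+σ)w) separately.
  set κ : ℝ → ℝ := fun σ => (Ioo 0 1).indicator (fun σ => σ ^ (lam - 1 - α)) σ +
    ((Ici 1).indicator (fun σ => σ ^ (-1 - α)) σ + (Ici 1).indicator (fun σ => σ ^ (-3 / 2 : ℝ)) σ) with hκdef
  have hκ : IntegrableOn κ (Ioi 0) := by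
    refine Integrable.integrableOn (Integrable.add ?_ (Integrable.add ?_ ?_))
    · rw [integrable_indicator_iff measurableSet_Ioo]
      exact (intervalIntegral.integrableOn_Ioo_rpow_iff one_pos).2 (by linarith)
    · rw [integrable_indicator_iff measurableSet_Ici, integrableOn_Ici_iff_integrableOn_Ioi]
      exact integrableOn_Ioi_rpow_of_lt (by linarith) one_pos
    · rw [integrable_indicator_iff measurableSet_Ici, integrableOn_Ici_iff_integrableOn_Ioi]
      exact integrableOn_Ioi_rpow_of_lt (by norm_num) one_pos
  refine l2n_radMaj_ne_top hU hκ (C := K + 2 * wn α U)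
    (ENNReal.add_ne_top.2 ⟨ENNReal.coe_ne_top, ENNReal.mul_ne_top (by simp) hA⟩) ?_
  intro σ hσ
  have hrad : ∀ w : E n, rad 0 (-1) U (-1 - σ) w = U ((1 + σ) • w) := by
    intro w
    have : -1 * (-1 - σ) = 1 + σ := by ring
    simp only [rad, this, if_pos (show 0 < 1 + σ by linarith)]
    simp
  simp only [hrad]
  by_cases hσ1 : σ < 1
  · have hk : κ σ = σ ^ (-1 - α) * σ ^ lam := by
      simp only [hκdef]
      rw [indicator_of_mem (show σ ∈ Ioo 0 1 from ⟨hσ, hσ1⟩), indicator_of_notMem (by simpa using hσ1),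
        indicator_of_notMem (by simpa using hσ1), ← Real.rpow_add hσ]
      ring_nf
    calc _ ≤ ENNReal.ofReal (σ ^ (-1 - α)) * (K * ENNReal.ofReal (σ ^ lam)) := by
          gcongr
          have := hB (1 + σ) (by linarith) (by linarith)
          rwa [add_sub_cancel_left] at this
      _ = K * ‖κ σ‖ₑ := by
          rw [hk, Real.enorm_of_nonneg (by positivity), ENNReal.ofReal_mul (by positivity)]; ring
      _ ≤ _ := by gcongr; exact le_self_add
  · have hσ1 : 1 ≤ σ := not_lt.1 hσ1
    have hk : κ σ = σ ^ (-1 - α) + σ ^ (-3 / 2 : ℝ) := by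
      simp only [hκdef]
      rw [indicator_of_notMem (fun h => absurd h.2 (by linarith)), indicator_of_mem (by exact hσ1),
        indicator_of_mem (by exact hσ1), zero_add]
    have hUσ : Measurable fun w : E n => U ((1 + σ) • w) := hU.comp (by fun_prop)
    -- Dilation by 1+σ contributes (1+σ)^(α-n/2). The worst case n = 1 gives the decay -1-α + α-1/2
    -- = -3/2.
    have hpow : σ ^ (-1 - α) * (1 + σ) ^ (α - (n : ℝ) / 2) ≤ 2 * σ ^ (-3 / 2 : ℝ) := by
      have hn' : (1 : ℝ) ≤ n := by exact_mod_cast hn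
      have e1 : (1 + σ) ^ (α - (n : ℝ) / 2) ≤ (1 + σ) ^ (α - 1 / 2) :=
        Real.rpow_le_rpow_of_exponent_le (by linarith) (by linarith)
      have e2 : (1 + σ) ^ (α - 1 / 2) = (1 + σ) ^ α * (1 + σ) ^ (-1 / 2 : ℝ) := by
        rw [← Real.rpow_add (by linarith)]; ring_nf
      have e3 : (1 + σ) ^ α ≤ 2 * σ ^ α := by
        calc (1 + σ) ^ α ≤ (2 * σ) ^ α := Real.rpow_le_rpow (by linarith) (by linarith) h0.le
          _ = 2 ^ α * σ ^ α := Real.mul_rpow (by norm_num) hσ.le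
          _ ≤ 2 * σ ^ α := by
            gcongr
            calc (2 : ℝ) ^ α ≤ 2 ^ (1 : ℝ) := Real.rpow_le_rpow_of_exponent_le (by norm_num) h1.le
              _ = 2 := Real.rpow_one 2
      have e4 : (1 + σ) ^ (-1 / 2 : ℝ) ≤ σ ^ (-1 / 2 : ℝ) :=
        Real.rpow_le_rpow_of_nonpos hσ (by linarith) (by norm_num)
      calc _ ≤ σ ^ (-1 - α) * ((2 * σ ^ α) * σ ^ (-1 / 2 : ℝ)) := by
            gcongr
            rw [e2] at e1
            refine e1.trans ?_
            gcongr
        _ = 2 * (σ ^ (-1 - α) * σ ^ α * σ ^ (-1 / 2 : ℝ)) := by ring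
        _ = _ := by rw [← Real.rpow_add hσ, ← Real.rpow_add hσ]; ring_nf
    calc _ ≤ ENNReal.ofReal (σ ^ (-1 - α)) *
            (wn α U + ENNReal.ofReal ((1 + σ) ^ (α - (n : ℝ) / 2)) * wn α U) := by
          gcongr
          refine (wn_sub_le hU hUσ).trans ?_
          rw [wn_comp_smul hU (by linarith)]
      _ = (ENNReal.ofReal (σ ^ (-1 - α)) +
            ENNReal.ofReal (σ ^ (-1 - α) * (1 + σ) ^ (α - (n : ℝ) / 2))) * wn α U := by
          rw [ENNReal.ofReal_mul (by positivity)]; ring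
      _ ≤ (ENNReal.ofReal (2 * σ ^ (-1 - α)) + ENNReal.ofReal (2 * σ ^ (-3 / 2 : ℝ))) * wn α U := by
          gcongr
          have : 0 ≤ σ ^ (-1 - α) := by positivity
          linarith
      _ = 2 * wn α U * ‖κ σ‖ₑ := by
          rw [hk, Real.enorm_of_nonneg (by positivity), ← ENNReal.ofReal_add (by positivity) (by positivity),
            ← mul_add, ENNReal.ofReal_mul (by norm_num)]
          norm_num; ring
      _ ≤ _ := by gcongr; exact le_add_self

/-- A contraction by 1-σ is the expansion by τ = 1/(1-σ) ≤ 2 seen from the point (1-σ)w, and τ - 1 ≤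
2σ. -/
theorem wn_sub_smul_le_of_le_one (hα0 : 0 < α) (hlam0 : 0 < lam) (hU : Measurable U) {K : ℝ≥0}
    (hB : ∀ τ : ℝ, 1 ≤ τ → τ ≤ 2 →
      wn α (fun w => U w - U (τ • w)) ≤ K * ENNReal.ofReal ((τ - 1) ^ lam)) :
    ∃ K' : ℝ≥0, ∀ σ : ℝ, 0 < σ → σ ≤ 1 / 2 →
      wn α (fun w => U w - U ((1 - σ) • w)) ≤ K' * ENNReal.ofReal (σ ^ lam) := by
  refine ⟨((1 / 2 : ℝ) ^ (-(n : ℝ) / 2)).toNNReal * K * ((2 : ℝ) ^ lam).toNNReal, fun σ hσ hσ2 => ?_⟩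
  set τ := 1 - σ with hτ
  have hτ2 : 1 / 2 ≤ τ := by linarith
  have hτ0 : 0 < τ := by linarith
  have hτi : 1 ≤ τ⁻¹ := (one_le_inv₀ hτ0).2 (by linarith)
  have hτi2 : τ⁻¹ ≤ 2 := by rw [inv_le_comm₀ hτ0 two_pos]; linarith
  have hm : Measurable fun w : E n => U w - U (τ⁻¹ • w) := hU.sub (hU.comp (by fun_prop))
  have e1 : wn α (fun w => U w - U (τ • w)) = wn α (fun w => U (τ • w) - U (τ⁻¹ • (τ • w))) := by
    unfold wn
    congr 1; funext w
    unfold wt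
    simp only [smul_smul, inv_mul_cancel₀ hτ0.ne', one_smul]
    rw [← enorm_neg, neg_sub]
  rw [e1, wn_comp_smul (u := fun w => U w - U (τ⁻¹ • w)) hm hτ0]
  have e2 : τ ^ (α - (n : ℝ) / 2) ≤ (1 / 2 : ℝ) ^ (-(n : ℝ) / 2) := by
    have hn : (0 : ℝ) ≤ n := n.cast_nonneg
    calc τ ^ (α - (n : ℝ) / 2) ≤ τ ^ (-(n : ℝ) / 2) :=
          Real.rpow_le_rpow_of_exponent_ge hτ0 (by linarith) (by linarith)
      _ ≤ _ := Real.rpow_le_rpow_of_nonpos (by norm_num) hτ2 (by linarith)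
  have e3 : (τ⁻¹ - 1) ^ lam ≤ 2 ^ lam * σ ^ lam := by
    rw [← Real.mul_rpow (by norm_num) hσ.le]
    refine Real.rpow_le_rpow (by linarith) ?_ hlam0.le
    have : τ⁻¹ - 1 = τ⁻¹ * σ := by rw [hτ] at hτ0 ⊢; field_simp; ring
    rw [this]; gcongr
  calc _ ≤ ENNReal.ofReal ((1 / 2 : ℝ) ^ (-(n : ℝ) / 2)) * (K * ENNReal.ofReal (2 ^ lam * σ ^ lam)) := by
        gcongr
        refine (hB _ hτi hτi2).trans ?_
        gcongr
    _ = _ := by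
        rw [ENNReal.ofReal_mul (by positivity)]; push_cast; simp only [ENNReal.ofReal]; ring

theorem l2n_radMaj_left_ne_top (hn : 1 ≤ n) (h0 : 0 < α) (h1 : α < 1) (hlam : α < lam) (hlam1 : lam ≤ 1)
    (hU : Measurable U) (hA : wn α U ≠ ⊤) {K : ℝ≥0} (hB : ∀ τ : ℝ, 1 ≤ τ → τ ≤ 2 →
      wn α (fun w => U w - U (τ • w)) ≤ K * ENNReal.ofReal ((τ - 1) ^ lam)) :
    l2n volume (radMaj α (n - 1) 1 U) ≠ ⊤ := by
  obtain ⟨K', hK'⟩ := wn_sub_smul_le_of_le_one h0 (h0.trans hlam) hU hB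
  -- The last term is the singularity at σ = 1, where the ray reaches P; beyond it only U(w)
  -- remains.
  set κ : ℝ → ℝ := fun σ => (Ioc 0 (1 / 2)).indicator (fun σ => σ ^ (lam - 1 - α)) σ +
    ((Ioi (1 / 2)).indicator (fun σ => σ ^ (-1 - α)) σ +
      (Ioo (1 / 2) 1).indicator (fun σ => (1 - σ) ^ (-1 / 2 : ℝ)) σ) with hκdef
  have hκ : IntegrableOn κ (Ioi 0) := by
    refine Integrable.integrableOn (Integrable.add ?_ (Integrable.add ?_ ?_))
    · rw [integrable_indicator_iff measurableSet_Ioc, integrableOn_Ioc_iff_integrableOn_Ioo]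
      exact (intervalIntegral.integrableOn_Ioo_rpow_iff (by norm_num)).2 (by linarith)
    · rw [integrable_indicator_iff measurableSet_Ioi]
      exact integrableOn_Ioi_rpow_of_lt (by linarith) (by norm_num)
    · have h2 : Integrable ((Ioo (0 : ℝ) (1 / 2)).indicator fun τ => τ ^ (-1 / 2 : ℝ)) := by
        rw [integrable_indicator_iff measurableSet_Ioo]
        exact (intervalIntegral.integrableOn_Ioo_rpow_iff (by norm_num)).2 (by norm_num)
      refine (h2.comp_sub_left 1).congr (Eventually.of_forall fun σ => ?_)
      have : 1 - σ ∈ Ioo (0 : ℝ) (1 / 2) ↔ σ ∈ Ioo (1 / 2 : ℝ) 1 := by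
        simp only [mem_Ioo]; constructor <;> rintro ⟨a, b⟩ <;> constructor <;> linarith
      simp only [indicator, this]
  refine l2n_radMaj_ne_top hU hκ (C := K' + (n - 1 : ℕ) * wn α U + 4 * wn α U)
    (by simp [ENNReal.add_eq_top, ENNReal.mul_eq_top, hA]) ?_
  intro σ hσ
  have hn' : ((n - 1 : ℕ) : ℝ) = n - 1 := by push_cast [hn]; ring
  have hn1 : (1 : ℝ) ≤ n := by exact_mod_cast hn
  have hUσ : Measurable fun w : E n => U ((1 - σ) • w) := hU.comp (by fun_prop)
  by_cases hσ1 : σ < 1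
  · have hτ0 : 0 < 1 - σ := by linarith
    have hrad : ∀ w : E n, rad (n - 1) 1 U (1 - σ) w = ((1 - σ) ^ (n - 1)) • U ((1 - σ) • w) := by
      intro w
      simp only [rad, one_mul, if_pos hτ0]
    simp only [hrad]
    by_cases hσ2 : σ ≤ 1 / 2
    · have hk : κ σ = σ ^ (-1 - α) * σ ^ lam := by
        simp only [hκdef]
        rw [indicator_of_mem (show σ ∈ Ioc 0 (1 / 2) from ⟨hσ, hσ2⟩),
          indicator_of_notMem (by simpa using hσ2),
          indicator_of_notMem (fun h => absurd h.1 (by simpa using hσ2)), ← Real.rpow_add hσ]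
        ring_nf
      set q := (1 - σ) ^ (n - 1) with hq
      have hq1 : q ≤ 1 := pow_le_one₀ hτ0.le (by linarith)
      have hq0 : 0 ≤ q := by positivity
      -- Bernoulli's inequality: the weight t^(n-1) perturbs the difference only to first order in
      -- σ.
      have hqb : 1 - q ≤ (n - 1 : ℕ) * σ ^ lam := by
        have := one_add_mul_le_pow (show -2 ≤ -σ by linarith) (n - 1)
        rw [← sub_eq_add_neg] at this
        have h3 : σ ≤ σ ^ lam := Real.self_le_rpow_of_le_one hσ.le (by linarith) hlam1
        have h4 : ((n - 1 : ℕ) : ℝ) * σ ≤ (n - 1 : ℕ) * σ ^ lam := by gcongr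
        linarith
      have hsplit : ∀ w : E n, U w - q • U ((1 - σ) • w) =
          q • (U w - U ((1 - σ) • w)) + (1 - q) • U w := by
        intro w; simp only [Complex.real_smul]; push_cast; ring
      simp only [hsplit]
      calc _ ≤ ENNReal.ofReal (σ ^ (-1 - α)) * (K' * ENNReal.ofReal (σ ^ lam) +
              ENNReal.ofReal ((n - 1 : ℕ) * σ ^ lam) * wn α U) := by
            gcongr
            refine (wn_add_le (u := fun w => q • (U w - U ((1 - σ) • w))) (v := fun w => (1 - q) • U w)
              ((hU.sub hUσ).const_smul q) (hU.const_smul (1 - q))).trans ?_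
            rw [wn_smul (U := fun w => U w - U ((1 - σ) • w)) (hU.sub hUσ), wn_smul hU,
              Real.enorm_of_nonneg hq0, Real.enorm_of_nonneg (by linarith)]
            refine add_le_add ((mul_le_of_le_one_left zero_le ?_).trans (hK' σ hσ hσ2)) (by gcongr)
            simpa using hq1
        _ = (K' + (n - 1 : ℕ) * wn α U) * ‖κ σ‖ₑ := by
            rw [hk, Real.enorm_of_nonneg (by positivity), ENNReal.ofReal_mul (by positivity),
              ENNReal.ofReal_mul (by positivity), ENNReal.ofReal_natCast]
            ring
        _ ≤ _ := mul_le_mul' le_self_add le_rfl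
    · have hσ2 : 1 / 2 < σ := not_le.1 hσ2
      have hk : κ σ = σ ^ (-1 - α) + (1 - σ) ^ (-1 / 2 : ℝ) := by
        simp only [hκdef]
        rw [indicator_of_notMem (fun h => absurd h.2 (by linarith)), indicator_of_mem (by exact hσ2),
          indicator_of_mem (show σ ∈ Ioo (1 / 2) 1 from ⟨hσ2, hσ1⟩), zero_add]
      -- The exponent n - 1 + α - n/2 is at least -1/2 because n ≥ 1.
      have hp1 : (1 - σ) ^ (n - 1) * (1 - σ) ^ (α - (n : ℝ) / 2) ≤ (1 - σ) ^ (-1 / 2 : ℝ) := by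
        rw [← Real.rpow_natCast, ← Real.rpow_add hτ0]
        exact Real.rpow_le_rpow_of_exponent_ge hτ0 (by linarith) (by rw [hn']; linarith)
      have hp2 : σ ^ (-1 - α) ≤ 4 := by
        calc σ ^ (-1 - α) ≤ (1 / 2 : ℝ) ^ (-1 - α) :=
              Real.rpow_le_rpow_of_nonpos (by norm_num) hσ2.le (by linarith)
          _ ≤ (1 / 2 : ℝ) ^ (-2 : ℝ) :=
              Real.rpow_le_rpow_of_exponent_ge (by norm_num) (by norm_num) (by linarith)
          _ = 4 := by
              rw [Real.rpow_neg (by norm_num), Real.rpow_two]; norm_num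
      calc _ ≤ ENNReal.ofReal (σ ^ (-1 - α)) * (wn α U +
              ENNReal.ofReal ((1 - σ) ^ (-1 / 2 : ℝ)) * wn α U) := by
            gcongr
            refine (wn_sub_le (v := fun w => ((1 - σ) ^ (n - 1)) • U ((1 - σ) • w)) hU
              (hUσ.const_smul ((1 - σ) ^ (n - 1)))).trans ?_
            rw [wn_smul (U := fun w => U ((1 - σ) • w)) hUσ, wn_comp_smul hU hτ0,
              Real.enorm_of_nonneg (by positivity), ← mul_assoc, ← ENNReal.ofReal_mul (by positivity)]
            gcongr
        _ = (ENNReal.ofReal (σ ^ (-1 - α)) +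
              ENNReal.ofReal (σ ^ (-1 - α) * (1 - σ) ^ (-1 / 2 : ℝ))) * wn α U := by
            rw [ENNReal.ofReal_mul (by positivity)]; ring
        _ ≤ (ENNReal.ofReal (4 * σ ^ (-1 - α)) + ENNReal.ofReal (4 * (1 - σ) ^ (-1 / 2 : ℝ))) * wn α U := by
            gcongr
            have : 0 ≤ σ ^ (-1 - α) := by positivity
            linarith
        _ = 4 * wn α U * ‖κ σ‖ₑ := by
            rw [hk, Real.enorm_of_nonneg (by positivity),
              ← ENNReal.ofReal_add (by positivity) (by positivity), ← mul_add,
              ENNReal.ofReal_mul (by norm_num)]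
            norm_num; ring
        _ ≤ _ := by gcongr; exact le_add_self
  · have hσ1 : 1 ≤ σ := not_lt.1 hσ1
    have hk : κ σ = σ ^ (-1 - α) := by
      simp only [hκdef]
      rw [indicator_of_notMem (fun h => absurd h.2 (by linarith)),
        indicator_of_mem (show σ ∈ Ioi (1 / 2 : ℝ) from by rw [mem_Ioi]; linarith),
        indicator_of_notMem (fun h => absurd h.2 (by linarith)), zero_add, add_zero]
    have hrad : ∀ w : E n, rad (n - 1) 1 U (1 - σ) w = 0 := by
      intro w
      simp only [rad, one_mul, if_neg (show ¬ 0 < 1 - σ by linarith)]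
    simp only [hrad, sub_zero]
    rw [hk, Real.enorm_of_nonneg (by positivity), mul_comm]
    gcongr
    calc wn α U = 1 * wn α U := (one_mul _).symm
      _ ≤ 4 * wn α U := by gcongr; norm_num
      _ ≤ _ := le_add_self

theorem ae_radInverts_left (hn : 1 ≤ n) (h0 : 0 < α) (h1 : α < 1) (hU : Measurable U)
    (hfin : l2n volume (radMaj α (n - 1) 1 U) ≠ ⊤) :
    ∀ᵐ w, RadInverts α (n - 1) 1 (α⁻¹ * betaConst α) (radDeriv α (n - 1) 1 U) U w := by
  have : Nonempty (Fin n) := ⟨⟨0, hn⟩⟩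
  refine ae_of_ae_ae_smul (measurableSet_radInverts (stronglyMeasurable_radDeriv hU).measurable hU) ?_
  have hset : ∀ X : ℕ, Iio (X : ℝ) ∩ {r : ℝ | 0 < 1 * r} = Ioo 0 (X : ℝ) := by
    intro X; ext r; simp [and_comm]
  have hX : ∀ X : ℕ, ∀ᵐ v : E n, ∫⁻ r in Iio (X : ℝ) ∩ {r | 0 < 1 * r},
      ENNReal.ofReal ((1 * r) ^ (n - 1)) * radMaj α (n - 1) 1 U ((1 * r) • v) ≠ ⊤ := by
    intro X
    refine ae_lintegral_smul_ne_top (measurable_radMaj hU) hfin ?_ (fun t ht => ht.2) ?_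
    · rw [hset]; exact measurableSet_Ioo
    · rw [hset]
      -- The weight t^(n-1) compensates the dilation cost t^(-n/2), and n/2 - 1 > -1.
      have hi : IntegrableOn (fun t : ℝ => t ^ ((n : ℝ) / 2 - 1)) (Ioo 0 (X : ℝ)) := by
        rcases X.eq_zero_or_pos with rfl | hX
        · simp
        · refine (intervalIntegral.integrableOn_Ioo_rpow_iff (by exact_mod_cast hX)).2 ?_
          have : (1 : ℝ) ≤ n := by exact_mod_cast hn
          linarith
      refine (integrableOn_congr_fun (fun t ht => ?_) measurableSet_Ioo).1 hi
      rw [one_mul, ← Real.rpow_natCast, ← Real.rpow_add ht.1]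
      push_cast [hn]
      ring_nf
  have hne : ∀ᵐ v : E n, v ≠ 0 := by simp [ae_iff]
  filter_upwards [ae_all_iff.2 hX, hne] with v hv hv0
  have hall : ∀ᵐ r : ℝ, ∀ X : ℕ, r < X → 0 < 1 * r →
      RadInverts α (n - 1) 1 (α⁻¹ * betaConst α) (radDeriv α (n - 1) 1 U) U ((1 * r) • v) := by
    refine ae_all_iff.2 fun X => ?_
    have := ae_radInverts_ray (X := X) (a := 0) h0 h1 hU (Or.inl rfl) hv0
      (fun r hr => by simp only [rad, one_mul, if_neg (not_lt.2 hr)]) (hv X)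
    rwa [ae_restrict_iff' measurableSet_Iio] at this
  rw [ae_restrict_iff' measurableSet_Ioi]
  filter_upwards [hall] with r hr hr0
  have hr0 : 0 < r := hr0
  obtain ⟨X, hX⟩ := exists_nat_gt r
  have := hr X hX (by linarith)
  rwa [one_mul] at this

theorem ae_radInverts_right (hn : 1 ≤ n) (h0 : 0 < α) (h1 : α < 1) (hU : Measurable U) {R : ℝ}
    (hR : ∀ w, R < ‖w‖ → U w = 0) (hfin : l2n volume (radMaj α 0 (-1) U) ≠ ⊤) :
    ∀ᵐ w, RadInverts α 0 (-1) (α⁻¹ * betaConst α) (radDeriv α 0 (-1) U) U w := by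
  have : Nonempty (Fin n) := ⟨⟨0, hn⟩⟩
  refine ae_of_ae_ae_smul (measurableSet_radInverts (stronglyMeasurable_radDeriv hU).measurable hU) ?_
  have hMaj : ∀ w, R < ‖w‖ → radMaj α 0 (-1) U w = 0 := by
    intro w hw
    unfold radMaj
    rw [setLIntegral_congr_fun (g := fun _ => 0) measurableSet_Ioi, lintegral_zero]
    intro σ hσ
    have hσ : 0 < σ := hσ
    have : U ((1 + σ) • w) = 0 := by
      refine hR _ ?_
      rw [norm_smul, Real.norm_of_nonneg (by linarith)]
      nlinarith [norm_nonneg w]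
    simp only [wt, rad, hR w hw, show -1 * (-1 - σ) = 1 + σ by ring, if_pos (show 0 < 1 + σ by linarith),
      this, smul_zero, sub_zero, enorm_zero, mul_zero]
  -- With no weight on the ray, |t|^(-n/2) need not be integrable at 0, so the parameter is kept
  -- below -1/(m+1) and m varies.
  set X : ℕ → ℝ := fun m => -(1 / ((m : ℝ) + 1)) with hXdef
  have hX0 : ∀ m, X m < 0 := fun m => by rw [hXdef]; simp; positivity
  have hY : ∀ m Y : ℕ, ∀ᵐ v : E n, ∫⁻ r in Ioo (-(Y : ℝ)) (X m),
      ENNReal.ofReal ((-1 * r) ^ 0) * radMaj α 0 (-1) U ((-1 * r) • v) ≠ ⊤ := by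
    intro m Y
    refine ae_lintegral_smul_ne_top (measurable_radMaj hU) hfin measurableSet_Ioo
      (fun t ht => by linarith [ht.2, hX0 m]) ?_
    refine IntegrableOn.mono_set (ContinuousOn.integrableOn_Icc ?_) Ioo_subset_Icc_self
    refine ContinuousOn.mul (by fun_prop) (ContinuousOn.rpow_const (by fun_prop) fun t ht => Or.inl ?_)
    linarith [ht.2, hX0 m]
  have hne : ∀ᵐ v : E n, v ≠ 0 := by simp [ae_iff]
  filter_upwards [ae_all_iff.2 fun m => ae_all_iff.2 (hY m), hne] with v hv hv0
  have hvp : 0 < ‖v‖ := norm_pos_iff.2 hv0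
  -- Beyond distance Y|v| > R both U and its majorant vanish, which makes the parameter interval
  -- bounded.
  obtain ⟨Y, hYR⟩ := exists_nat_gt (R / ‖v‖)
  rw [div_lt_iff₀ hvp] at hYR
  have hfar : ∀ r : ℝ, r ≤ -Y → R < ‖(-1 * r) • v‖ := by
    intro r hr
    have : (0 : ℝ) ≤ Y := Y.cast_nonneg
    rw [norm_smul, Real.norm_of_nonneg (by linarith)]
    nlinarith
  have hall : ∀ᵐ r : ℝ, ∀ m : ℕ, r < X m → 0 < -1 * r →
      RadInverts α 0 (-1) (α⁻¹ * betaConst α) (radDeriv α 0 (-1) U) U ((-1 * r) • v) := by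
    refine ae_all_iff.2 fun m => ?_
    have := ae_radInverts_ray (k := 0) (X := X m) (a := -(Y : ℝ)) h0 h1 hU
      (Or.inr ⟨rfl, (hX0 m).le⟩) hv0
      (fun r hr => by simp only [rad, hR _ (hfar r hr), smul_zero, ite_self]) ?_
    · rwa [ae_restrict_iff' measurableSet_Iio] at this
    · refine ne_top_of_le_ne_top (hv m Y) ?_
      have hset : MeasurableSet (Iio (X m) ∩ {r : ℝ | 0 < -1 * r}) :=
        measurableSet_Iio.inter (measurableSet_lt measurable_const (by fun_prop))
      rw [setLIntegral_congr_fun (g := (Ioi (-(Y : ℝ))).indicator fun r =>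
        ENNReal.ofReal ((-1 * r) ^ 0) * radMaj α 0 (-1) U ((-1 * r) • v)) hset,
        setLIntegral_indicator measurableSet_Ioi]
      · exact lintegral_mono_set fun r hr => ⟨hr.1, hr.2.1⟩
      · intro r hr
        by_cases hrY : -(Y : ℝ) < r
        · rw [indicator_of_mem (by exact hrY)]
        · rw [indicator_of_notMem (by exact hrY)]
          simp only [hMaj _ (hfar r (not_lt.1 hrY)), mul_zero]
  have hneg : ∀ᵐ t : ℝ, ∀ m : ℕ, -t < X m → 0 < -1 * -t →
      RadInverts α 0 (-1) (α⁻¹ * betaConst α) (radDeriv α 0 (-1) U) U ((-1 * -t) • v) :=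
    (Measure.measurePreserving_neg (volume : Measure ℝ)).quasiMeasurePreserving.ae hall
  rw [ae_restrict_iff' measurableSet_Ioi]
  filter_upwards [hneg] with t ht ht0
  have ht0 : 0 < t := ht0
  obtain ⟨m, hm⟩ := exists_nat_one_div_lt ht0
  have := ht m (by rw [hXdef]; simpa using neg_lt_neg hm) (by linarith)
  rwa [neg_one_mul, neg_neg] at this

end Bounds

/-! ### From the normalised ray identity to the directional fractional integrals -/

section Classes

variable {n : ℕ} {Ω : Set (E n)} {P : E n} {α c : ℝ} {U g : E n → ℂ}

theorem smul_dir {Q : E n} (hQ : Q ≠ P) (s : ℝ) : (‖Q - P‖ * s) • dir P Q = s • (Q - P) := by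
  have : ‖Q - P‖ ≠ 0 := norm_ne_zero_iff.2 (sub_ne_zero.2 hQ)
  rw [dir, smul_smul]
  congr 1
  field_simp

theorem rpow_kernel {r σ : ℝ} (hr : 0 < r) (hσ : 0 < σ) :
    ((r * σ) ^ (1 - α))⁻¹ = r ^ (α - 1) * σ ^ (α - 1) := by
  rw [← Real.rpow_neg (by positivity), Real.mul_rpow hr.le hσ.le, neg_sub]

theorem memLp_of_radMaj {k : ℕ} {e : ℝ} (hU : Measurable U) (hfin : l2n volume (radMaj α k e U) ≠ ⊤)
    (b : ℂ) : MemLp (fun Q => b * radDeriv α k e U (Q - P)) 2 (volume.restrict Ω) := by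
  have h1 : MemLp (radDeriv α k e U) 2 volume := by
    refine ⟨(stronglyMeasurable_radDeriv hU).aestronglyMeasurable, ?_⟩
    rw [← l2n_eq_eLpNorm]
    exact (l2n_mono enorm_radDeriv_le).trans_lt (lt_top_iff_ne_top.2 hfin)
  exact ((h1.comp_measurePreserving (measurePreserving_sub_right volume P)).const_mul b).restrict Ω

/-- Substitution t = r(1-σ): then t/r = 1-σ is the weight in `rad`, and `rad` cuts the integral off
at σ = 1, that is, at P. -/
theorem leftInt_of_radInverts {Q : E n} (hQ : Q ≠ P) (b : ℂ)
    (h : RadInverts α (n - 1) 1 c g U (Q - P)) :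
    IntervalIntegrable (leftIntegrand α P (fun Q => b * g (Q - P)) Q) volume 0 ‖Q - P‖ ∧
      leftInt α P (fun Q => b * g (Q - P)) Q = b / (Real.Gamma α : ℂ) * (c • U (Q - P)) := by
  set w := Q - P with hw
  have hr : 0 < ‖w‖ := norm_pos_iff.2 (sub_ne_zero.2 hQ)
  set r := ‖w‖ with hrdef
  set L := leftIntegrand α P (fun Q => b * g (Q - P)) Q with hL
  set q : ℝ → ℂ := fun σ => σ ^ (α - 1) • rad (n - 1) 1 g (1 - σ) w with hq
  have hLq : ∀ σ ∈ Ioo (0 : ℝ) 1, L (r - r * σ) = (b * (r ^ (α - 1) : ℝ)) * q σ := by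
    intro σ hσ
    have h1 : 0 < 1 - σ := by linarith [hσ.2]
    have e1 : r - r * σ = r * (1 - σ) := by ring
    simp only [hL, leftIntegrand, hq]
    rw [← hw, ← hrdef, e1, smul_dir hQ, add_sub_cancel_left, rad, one_mul, if_pos h1,
      show r - r * (1 - σ) = r * σ by ring, mul_div_cancel_left₀ _ hr.ne', div_eq_mul_inv,
      ← Complex.ofReal_inv, rpow_kernel hr hσ.1, Complex.real_smul, Complex.real_smul, ← hw]
    push_cast; ring
  have hq0 : ∀ σ ∈ Ioi (0 : ℝ) \ Ioo 0 1, q σ = 0 := by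
    rintro σ ⟨hσ, hσ'⟩
    have : ¬ 0 < 1 * (1 - σ) := fun h => hσ' ⟨hσ, by linarith⟩
    simp only [hq, rad, if_neg this, smul_zero]
  have hqi : IntegrableOn q (Ioo 0 1) := h.1.mono_set Ioo_subset_Ioi_self
  have hqint : ∫ σ in Ioi (0 : ℝ), q σ = ∫ σ in Ioo (0 : ℝ) 1, q σ :=
    setIntegral_eq_of_subset_of_forall_sdiff_eq_zero measurableSet_Ioi Ioo_subset_Ioi_self hq0
  have hLi : IntervalIntegrable (fun σ => L (r - r * σ)) volume 0 1 := by
    rw [intervalIntegrable_iff_integrableOn_Ioo_of_le zero_le_one]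
    exact (integrableOn_congr_fun hLq measurableSet_Ioo).2 (Integrable.const_mul hqi _)
  constructor
  · have h2 := ((hLi.comp_sub_left 1).symm.comp_mul_left (c := r⁻¹))
    have e : (fun x => L (r - r * (1 - r⁻¹ * x))) = L := by
      funext x; congr 1; field_simp; ring
    rw [e] at h2
    simpa using h2
  · have h2 := intervalIntegral.integral_comp_sub_mul (a := 0) (b := 1) L hr.ne' r
    rw [mul_zero, sub_zero, mul_one, sub_self, intervalIntegral.integral_of_le zero_le_one,
      integral_Ioc_eq_integral_Ioo, setIntegral_congr_fun measurableSet_Ioo hLq,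
      integral_const_mul, ← hqint] at h2
    have h3 := h.2
    rw [← h3, leftInt, ← hw, ← hrdef, ← hL]
    have h4 : ∫ x in (0 : ℝ)..r, L x = r • (b * (r ^ (α - 1) : ℝ) * ∫ σ in Ioi (0 : ℝ), q σ) := by
      rw [h2, smul_smul, mul_inv_cancel₀ hr.ne', one_smul]
    rw [h4]
    have h5 : r ^ α = r * r ^ (α - 1) := by
      rw [Real.rpow_sub_one hr.ne']; field_simp
    rw [h5, Complex.real_smul, Complex.real_smul]
    push_cast; ring

/-- Substitution t = r(1+σ). Points with t > d lie outside Ω by the definition of d as a supremum;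
there g vanishes, so the integral over σ > 0 stops at m = d/r - 1. -/
theorem rightInt_of_radInverts {Q : E n} (hQ : Q ≠ P) (b : ℂ) (hQΩ : Q ∈ Ω)
    (hbdd : BddAbove {t : ℝ | 0 < t ∧ P + t • dir P Q ∈ Ω}) (hg : ∀ w, P + w ∉ Ω → g w = 0)
    (h : RadInverts α 0 (-1) c g U (Q - P)) :
    IntervalIntegrable (rightIntegrand α P (fun Q => b * g (Q - P)) Q) volume ‖Q - P‖
        (rayLength Ω P (dir P Q)) ∧
      rightInt α Ω P (fun Q => b * g (Q - P)) Q = b / (Real.Gamma α : ℂ) * (c • U (Q - P)) := by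
  set w := Q - P with hw
  have hr : 0 < ‖w‖ := norm_pos_iff.2 (sub_ne_zero.2 hQ)
  set r := ‖w‖ with hrdef
  set d := rayLength Ω P (dir P Q) with hd
  have hQd : P + (r * 1) • dir P Q ∈ Ω := by
    rw [hrdef, hw, smul_dir hQ, one_smul, add_sub_cancel]; exact hQΩ
  have hrd : r ≤ d := le_csSup hbdd ⟨hr, by rwa [mul_one] at hQd⟩
  set m : ℝ := d / r - 1 with hm
  have hm0 : 0 ≤ m := by rw [hm, sub_nonneg, one_le_div hr]; exact hrd
  have hmd : r + r * m = d := by rw [hm]; field_simp; ring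
  set L := rightIntegrand α P (fun Q => b * g (Q - P)) Q with hL
  set q : ℝ → ℂ := fun σ => σ ^ (α - 1) • rad 0 (-1) g (-1 - σ) w with hq
  have hrad : ∀ σ, 0 < σ → rad 0 (-1) g (-1 - σ) w = g ((1 + σ) • w) := by
    intro σ hσ
    rw [rad, show -1 * (-1 - σ) = 1 + σ by ring, if_pos (by linarith), pow_zero, one_smul]
  have hLq : ∀ σ ∈ Ioc (0 : ℝ) m, L (r + r * σ) = (b * (r ^ (α - 1) : ℝ)) * q σ := by
    intro σ hσ
    have e1 : r + r * σ = r * (1 + σ) := by ring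
    simp only [hL, rightIntegrand, hq]
    rw [hrad σ hσ.1, ← hw, ← hrdef, e1, smul_dir hQ, add_sub_cancel_left,
      show r * (1 + σ) - r = r * σ by ring, div_eq_mul_inv,
      ← Complex.ofReal_inv, rpow_kernel hr hσ.1, Complex.real_smul, ← hw]
    push_cast; ring
  have hq0 : ∀ σ ∈ Ioi (0 : ℝ) \ Ioc 0 m, q σ = 0 := by
    rintro σ ⟨hσ, hσ'⟩
    have hσ : 0 < σ := hσ
    have hmσ : m < σ := by
      by_contra hc
      exact hσ' ⟨hσ, not_lt.1 hc⟩
    simp only [hq]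
    rw [hrad σ hσ, hg, smul_zero]
    intro hmem
    rw [hw, ← smul_dir hQ, ← hw, ← hrdef] at hmem
    have : r * (1 + σ) ≤ d := le_csSup hbdd ⟨by positivity, hmem⟩
    nlinarith
  have hqi : IntegrableOn q (Ioc 0 m) := h.1.mono_set Ioc_subset_Ioi_self
  have hqint : ∫ σ in Ioi (0 : ℝ), q σ = ∫ σ in Ioc (0 : ℝ) m, q σ :=
    setIntegral_eq_of_subset_of_forall_sdiff_eq_zero measurableSet_Ioi Ioc_subset_Ioi_self hq0
  have hLi : IntervalIntegrable (fun σ => L (r + r * σ)) volume 0 m := by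
    rw [intervalIntegrable_iff_integrableOn_Ioc_of_le hm0]
    exact (integrableOn_congr_fun hLq measurableSet_Ioc).2 (Integrable.const_mul hqi _)
  constructor
  · have h2 := ((hLi.comp_mul_left (c := r⁻¹)).comp_sub_right r)
    have e : (fun x => L (r + r * (r⁻¹ * (x - r)))) = L := by
      funext x; congr 1; field_simp; ring
    rw [e] at h2
    convert h2 using 1
    · simp
    · rw [← hmd]; field_simp; ring
  · have h2 := intervalIntegral.integral_comp_add_mul (a := 0) (b := m) L hr.ne' r
    rw [mul_zero, add_zero, hmd, intervalIntegral.integral_of_le hm0,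
      setIntegral_congr_fun measurableSet_Ioc hLq, integral_const_mul, ← hqint] at h2
    have h3 := h.2
    rw [← h3, rightInt, ← hw, ← hrdef, ← hL, ← hd]
    have h4 : ∫ x in r..d, L x = r • (b * (r ^ (α - 1) : ℝ) * ∫ σ in Ioi (0 : ℝ), q σ) := by
      rw [h2, smul_smul, mul_inv_cancel₀ hr.ne', one_smul]
    rw [h4]
    have h5 : r ^ α = r * r ^ (α - 1) := by
      rw [Real.rpow_sub_one hr.ne']; field_simp
    rw [h5, Complex.real_smul, Complex.real_smul]
    push_cast; ring

/-- By convexity a ray that has left Ω does not return, so every value of U entering the integral is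
0. -/
theorem radDeriv_right_eq_zero (hΩ : IsOpen Ω) (hconv : Convex ℝ Ω) (hP : P ∈ closure Ω)
    (hU : ∀ w, P + w ∉ Ω → U w = 0) {w : E n} (hw : P + w ∉ Ω) : radDeriv α 0 (-1) U w = 0 := by
  unfold radDeriv
  rw [setIntegral_congr_fun (g := fun _ => (0 : ℂ)) measurableSet_Ioi, integral_zero]
  intro σ hσ
  have hσ : 0 < σ := hσ
  have h1 : 0 < 1 + σ := by linarith
  have : U ((1 + σ) • w) = 0 := by
    refine hU _ fun hmem => hw ?_
    have := hconv.add_smul_mem_interior' hP (y := (1 + σ) • w) (by rwa [hΩ.interior_eq])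
      (t := (1 + σ)⁻¹) ⟨by positivity, inv_le_one_of_one_le₀ (by linarith)⟩
    rwa [smul_smul, inv_mul_cancel₀ h1.ne', one_smul, hΩ.interior_eq] at this
  simp only [rad, hU w hw, show -1 * (-1 - σ) = 1 + σ by ring, if_pos h1, this, smul_zero, sub_zero]

end Classes
end DirFrac

/-! ### The theorem -/

theorem theorem2p4 {n : ℕ} (Ω : Set (DirFrac.E n)) (hopen : IsOpen Ω) (hconv : Convex ℝ Ω)
    (hbdd : Bornology.IsBounded Ω) (P : DirFrac.E n) (hP : P ∈ frontier Ω)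
    (α : ℝ) (hα0 : 0 < α) (hα1 : α < 1) (lam : ℝ≥0) (hlam : α < (lam : ℝ)) (hlam1 : lam ≤ 1)
    (ρ : DirFrac.E n → ℂ) (hρ : DirFrac.IsLip lam Ω ρ)
    (f : DirFrac.E n → ℂ) (hf : DirFrac.MemH01 Ω f) :
    (fun Q => ρ Q * f Q) ∈ DirFrac.LeftClass α 2 Ω P ∩ DirFrac.RightClass α 2 Ω P := by
  open DirFrac in
  have hPΩ : P ∉ Ω := by
    rw [hopen.frontier_eq] at hP; exact hP.2
  have hPc : P ∈ closure Ω := frontier_subset_closure hP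
  -- In dimension 0 the space is one point, so P in the closure of Ω would already lie in Ω.
  have hn : 1 ≤ n := by
    rcases Nat.eq_zero_or_pos n with rfl | h
    · obtain ⟨x, hx⟩ := closure_nonempty_iff.1 ⟨P, hPc⟩
      exact absurd (Subsingleton.elim x P ▸ hx) hPΩ
    · exact h
  obtain ⟨R₀, hR₀⟩ := hbdd.subset_closedBall P
  set R := max R₀ 0
  have hR : ∀ w, P + w ∈ Ω → ‖w‖ ≤ R := by
    intro w hw
    have := hR₀ hw
    simp at this
    exact this.trans (le_max_left _ _)
  obtain ⟨U, hU, hU0, hUf, hA, K, hB⟩ :=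
    exists_zeroExtension_mul hopen hconv hP (le_max_right _ _) hR hα0 hα1 hlam hlam1 hρ hf
  have hcpos : 0 < α⁻¹ * betaConst α := mul_pos (inv_pos.2 hα0) (betaConst_pos hα0 hα1)
  set c := α⁻¹ * betaConst α with hc
  have hΓ : (Real.Gamma α : ℂ) ≠ 0 := by exact_mod_cast (Real.Gamma_pos_of_pos hα0).ne'
  have hcC : (c : ℂ) ≠ 0 := by exact_mod_cast hcpos.ne'
  -- b cancels both the factor 1/Γ(α) and the inversion constant c.
  set b : ℂ := Real.Gamma α / c with hb
  have hbc : ∀ z : ℂ, b / (Real.Gamma α : ℂ) * (c • z) = z := by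
    intro z; rw [hb, Complex.real_smul]; field_simp
  have hsub := (measurePreserving_sub_right (volume : Measure (E n)) P).quasiMeasurePreserving
  have hUf' : ∀ᵐ Q : E n, Q ∈ Ω → U (Q - P) = ρ Q * f Q := by
    filter_upwards [hsub.ae hUf] with Q hQ hQΩ
    simpa [hQΩ] using hQ
  have hne : ∀ Q ∈ Ω, Q ≠ P := fun Q hQ h => hPΩ (h ▸ hQ)
  have hfinL := l2n_radMaj_left_ne_top hn hα0 hα1 hlam (by exact_mod_cast hlam1) hU hA hB
  have hfinR := l2n_radMaj_right_ne_top hn hα0 hα1 hlam hU hA hB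
  constructor
  · refine ⟨fun Q => b * radDeriv α (n - 1) 1 U (Q - P), memLp_of_radMaj hU hfinL b, ?_⟩
    rw [ae_restrict_iff' hopen.measurableSet]
    filter_upwards [hUf', hsub.ae (ae_radInverts_left hn hα0 hα1 hU hfinL)] with Q hQ hQi hQΩ
    obtain ⟨h1, h2⟩ := leftInt_of_radInverts (hne Q hQΩ) b hQi
    exact ⟨h1, by rw [h2, hbc, hQ hQΩ]⟩
  · refine ⟨fun Q => b * radDeriv α 0 (-1) U (Q - P), memLp_of_radMaj hU hfinR b, ?_⟩
    rw [ae_restrict_iff' hopen.measurableSet]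
    have hUR : ∀ w, R < ‖w‖ → U w = 0 := fun w hw => hU0 w fun h => absurd (hR w h) (not_le.2 hw)
    filter_upwards [hUf', hsub.ae (ae_radInverts_right hn hα0 hα1 hU hUR hfinR)] with Q hQ hQi hQΩ
    have hbd : BddAbove {t : ℝ | 0 < t ∧ P + t • dir P Q ∈ Ω} := by
      refine ⟨R, fun t ht => ?_⟩
      have h1 : ‖Q - P‖ ≠ 0 := norm_ne_zero_iff.2 (sub_ne_zero.2 (hne Q hQΩ))
      have h2 := hR _ ht.2
      rwa [norm_smul, dir, norm_smul, norm_inv, norm_norm, inv_mul_cancel₀ h1, mul_one,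
        Real.norm_of_nonneg ht.1.le] at h2
    obtain ⟨h1, h2⟩ := rightInt_of_radInverts (hne Q hQΩ) b hQΩ hbd
      (fun w hw => radDeriv_right_eq_zero hopen hconv hPc hU0 hw) hQi
    exact ⟨h1, by rw [h2, hbc, hQ hQΩ]⟩
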